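/- Theorem. A string $S=S[1]S[2]\dots S[n]$ has a 3-cadence if there are integers $i,d$ with $d>0$ such that $i,\,i+d,\,i+2d$ are indices in $\{1,\dots,n\}$ with $S[i]=S[i+d]=S[i+2d]$, and such that $i-d\le 0$ and $i+3d>n$. (a) Given a binary string by a straight-line grammar in Chomsky normal form (ordered nonterminals $v_1,\dots,v_m$ with $m\ge 1$ and start symbol $v_m$, where the right-hand side of each $v_i$ is either a character $0$ or $1$ or of the form $v_jv_k$ with $j,k<i$), it can be decided in time polynomial in the compressed size $m$ whether the string has a 3-cadence. (b) Given a binary string of length $n$ uncompressed, it can be decided in time $O(n)$ whether it has a 3-cadence. Time is measured on a random access machine whose operations on words (addition, subtraction, multiplication, division, remainder, comparison, memory access) take one step each; in (a) there are polynomially many steps on words with $m^{O(1)}$ bits (equivalently, polynomial bit complexity), and in (b) there are $O(n)$ steps on words with $O(\log n)$ bits. Here $O(n)$ and $O(\log n)$ are to be read as $O(n+1)$ and $O(1+\log (n+1))$, so that small $n$ are included. -/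

import Mathlib

/-! ### Strings and cadences -/

/-- The character `S[i]` of a string, indices running through `1, …, n`;
`none` if `i` is not an index of `S`. -/
def charAt {α : Type*} (S : List α) (i : ℤ) : Option α :=
  if 1 ≤ i then S[(i - 1).toNat]? else none

/-- `(i, d, k)` is a `k`-sub-cadence of `S`: `d > 0`, all of `i, i + d, …, i + (k - 1) d` are
indices of `S`, and `S` has the same character at each of them. -/
def IsSubCadence {α : Type*} (S : List α) (i d : ℤ) (k : ℕ) : Prop :=
  0 < d ∧ ∃ a : α, ∀ j : ℕ, j < k → charAt S (i + j * d) = some a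

/-- A `k`-cadence: a structurally maximal `k`-sub-cadence. -/
def IsCadence {α : Type*} (S : List α) (i d : ℤ) (k : ℕ) : Prop :=
  IsSubCadence S i d k ∧ i - d ≤ 0 ∧ (S.length : ℤ) < i + k * d

/-- `S` contains a `k`-cadence. -/
def HasCadence {α : Type*} (S : List α) (k : ℕ) : Prop :=
  ∃ i d : ℤ, IsCadence S i d k

/-! ### Grammar-compressed strings -/

/-- The possible right-hand sides of the nonterminal number `i`: a character, or
`v_j v_k` with `j, k < i`. -/
inductive GrammarRule (α : Type*) (i : ℕ) where
  | char (a : α) : GrammarRule α i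
  | pair (j k : Fin i) : GrammarRule α i

/-- A straight-line grammar in Chomsky normal form over the alphabet `α`. Its nonterminals are
`v_0, …, v_(size - 1)`; there is at least one, and the last one is the start symbol. -/
structure StraightLineGrammar (α : Type*) where
  /-- the number of nonterminals; this is the compressed size -/
  size : ℕ
  size_pos : 0 < size
  rhs : (i : Fin size) → GrammarRule α i

namespace StraightLineGrammar

/-- The string derived from the nonterminal `v_i`. -/
def expand {α : Type*} (G : StraightLineGrammar α) (i : ℕ) (h : i < G.size) : List α :=
  match G.rhs ⟨i, h⟩ with
  | .char a => [a]
  | .pair j k => G.expand j (j.isLt.trans h) ++ G.expand k (k.isLt.trans h)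
termination_by i
decreasing_by
  · exact j.isLt
  · exact k.isLt

/-- The string given by the grammar: the one derived from the start symbol. -/
def word {α : Type*} (G : StraightLineGrammar α) : List α :=
  G.expand (G.size - 1) (Nat.sub_lt G.size_pos Nat.one_pos)

end StraightLineGrammar

/-! ### The word RAM

A machine has registers and a randomly accessible memory, all holding words, that is,
natural numbers less than `2 ^ w`, where `w` is the word length. A program is finite and
fixed, hence mentions only finitely many registers, and it does not depend on `w`. -/

/-- The binary operations on words. -/
inductive WordOp where
  | add | sub | mul | div | mod | lt | eq

/-- Subtraction is truncated at `0`, `x / 0 = 0` and `x % 0 = x`, and a comparison yields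
`1` if it holds and `0` otherwise. -/
def WordOp.eval : WordOp → ℕ → ℕ → ℕ
  | .add, x, y => x + y
  | .sub, x, y => x - y
  | .mul, x, y => x * y
  | .div, x, y => x / y
  | .mod, x, y => x % y
  | .lt, x, y => if x < y then 1 else 0
  | .eq, x, y => if x = y then 1 else 0

/-- RAM programs; `x`, `y`, `z` are numbers of registers. -/
inductive RamProgram where
  /-- do nothing -/
  | skip : RamProgram
  /-- `reg x := c` -/
  | const (x c : ℕ) : RamProgram
  /-- `reg x := reg y ∘ reg z` for the operation `∘` -/
  | op (o : WordOp) (x y z : ℕ) : RamProgram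
  /-- `reg x := mem (reg y)` -/
  | load (x y : ℕ) : RamProgram
  /-- `mem (reg x) := reg y` -/
  | store (x y : ℕ) : RamProgram
  /-- first `P`, then `Q` -/
  | seq (P Q : RamProgram) : RamProgram
  /-- if `reg x ≠ 0` then `P` else `Q` -/
  | ite (x : ℕ) (P Q : RamProgram) : RamProgram
  /-- while `reg x ≠ 0` do `P` -/
  | loop (x : ℕ) (P : RamProgram) : RamProgram

/-- The contents of the registers and of the memory. -/
structure RamState where
  reg : ℕ → ℕ
  mem : ℕ → ℕ

/-- `RamProgram.Runs w P σ τ t`: on a machine with word length `w`, the program `P`, started in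
the state `σ`, halts in the state `τ` after exactly `t` steps. Every instruction and every
test of a condition is one step. There is no run in which a value that is not a word
would have to be written: a program has to avoid overflows. -/
inductive RamProgram.Runs (w : ℕ) : RamProgram → RamState → RamState → ℕ → Prop where
  | skip (σ : RamState) : Runs w .skip σ σ 1
  | const (σ : RamState) (x c : ℕ) (h : c < 2 ^ w) :
      Runs w (.const x c) σ ⟨Function.update σ.reg x c, σ.mem⟩ 1
  | op (σ : RamState) (o : WordOp) (x y z : ℕ) (h : o.eval (σ.reg y) (σ.reg z) < 2 ^ w) :
      Runs w (.op o x y z) σ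
        ⟨Function.update σ.reg x (o.eval (σ.reg y) (σ.reg z)), σ.mem⟩ 1
  | load (σ : RamState) (x y : ℕ) (h : σ.mem (σ.reg y) < 2 ^ w) :
      Runs w (.load x y) σ ⟨Function.update σ.reg x (σ.mem (σ.reg y)), σ.mem⟩ 1
  | store (σ : RamState) (x y : ℕ) (h : σ.reg y < 2 ^ w) :
      Runs w (.store x y) σ ⟨σ.reg, Function.update σ.mem (σ.reg x) (σ.reg y)⟩ 1
  | seq {P Q : RamProgram} {σ τ ρ : RamState} {s t : ℕ}
      (hP : Runs w P σ τ s) (hQ : Runs w Q τ ρ t) : Runs w (.seq P Q) σ ρ (s + t)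
  | ite_true {x : ℕ} {P Q : RamProgram} {σ τ : RamState} {t : ℕ}
      (hx : σ.reg x ≠ 0) (hP : Runs w P σ τ t) : Runs w (.ite x P Q) σ τ (t + 1)
  | ite_false {x : ℕ} {P Q : RamProgram} {σ τ : RamState} {t : ℕ}
      (hx : σ.reg x = 0) (hQ : Runs w Q σ τ t) : Runs w (.ite x P Q) σ τ (t + 1)
  | loop_exit {x : ℕ} {P : RamProgram} {σ : RamState}
      (hx : σ.reg x = 0) : Runs w (.loop x P) σ σ 1
  | loop_step {x : ℕ} {P : RamProgram} {σ τ ρ : RamState} {s t : ℕ}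
      (hx : σ.reg x ≠ 0) (hP : Runs w P σ τ s) (hloop : Runs w (.loop x P) τ ρ t) :
      Runs w (.loop x P) σ ρ (s + t + 1)

/-- The initial state for an input, a list of natural numbers: the input is in the memory cells
`0, 1, …`, its length is in register `0`, and everything else is `0`. -/
def RamState.init (input : List ℕ) : RamState where
  reg := fun x => if x = 0 then input.length else 0
  mem := fun a => input.getD a 0

/-- On a machine with word length `w`, which has to be large enough for the input, `P` halts on
the input after at most `T` steps, and it accepts (that is, register `0` is then
nonzero) if and only if the answer is yes. -/
def RamProgram.Decides (P : RamProgram) (w T : ℕ) (input : List ℕ) (answer : Prop) : Prop :=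
  (input.length < 2 ^ w ∧ ∀ v ∈ input, v < 2 ^ w) ∧
    ∃ (τ : RamState) (t : ℕ), P.Runs w (RamState.init input) τ t ∧ t ≤ T ∧
      (τ.reg 0 ≠ 0 ↔ answer)

/-- The decision problem `Q` on the instances `ι`, which are given to the machine by `enc` and
measured by `size`, can be solved in polynomial time: a single program solves it
with polynomially many steps on words with polynomially many bits. -/
def PolyTimeSolvable {ι : Type*} (enc : ι → List ℕ) (size : ι → ℕ) (Q : ι → Prop) : Prop :=
  ∃ (P : RamProgram) (p : Polynomial ℕ), ∀ a : ι,
    P.Decides (p.eval (size a)) (p.eval (size a)) (enc a) (Q a)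

/-- The decision problem `Q` can be solved in linear time on the word RAM: a single program
solves it with `O(n)` steps on words with `O(log n)` bits, where `n` is the size. -/
def LinearTimeSolvable {ι : Type*} (enc : ι → List ℕ) (size : ι → ℕ) (Q : ι → Prop) : Prop :=
  ∃ (P : RamProgram) (c : ℕ), ∀ a : ι,
    P.Decides (c * (Nat.log 2 (size a) + 1)) (c * (size a + 1)) (enc a) (Q a)

/-! ### Inputs -/

/-- An uncompressed binary string is given as the list of its characters. -/
def encodeString (S : List Bool) : List ℕ :=
  S.map Bool.toNat

/-- Three words for a right-hand side: `0, a, 0` for a character `a`, and `1, j, k` for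
`v_j v_k`. -/
def encodeRule {i : ℕ} : GrammarRule Bool i → List ℕ
  | .char a => [0, a.toNat, 0]
  | .pair j k => [1, j, k]

/-- A grammar is given as the list of its right-hand sides, in the order of the nonterminals. -/
def encodeGrammar (G : StraightLineGrammar Bool) : List ℕ :=
  (List.finRange G.size).flatMap fun i => encodeRule (G.rhs i)

/-!
A 3-cadence is given by its first position `x` and its last position `z`, which have the same
parity and satisfy `3 x ≤ z` and `3 z - x ≥ 2 n + 2`; the middle one is `(x + z) / 2`. The set of
admissible pairs is closed under decreasing `x` and increasing `z`. Fix a parity class.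

Suppose that the character changes from `x` to `x + 2` and from `z` to `z + 2`, where `(x + 2, z)`
is admissible. If `s x = s (z + 2)`, then `(x, z + 2)` and `(x + 2, z)` are two pairs of equal
characters, with different characters for the two pairs and with a common midpoint. Whatever the
character at the midpoint is, there is a cadence (`HasThreeCadence.of_crossing`). Such a pair of
opposite changes is a crossing.

Let `c` be the last position of the class whose character differs from that at the right end `t` of
the class (`lastChange`). Last positions after `c` all carry the character `s t`. The cadences
with such a last position are found by descending alternately (`Scan`): from a first position
`x` to the last middle position `y ≤ (x + t) / 2` with `s y = s t`, and from `y` to the last first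
position that fits `y` and carries `s t`. As long as this does not succeed, the distance `t - 3 x`
essentially doubles, provided that `c` is not involved in a crossing (`nextPos_gap`), so there
are `O(log n)` rounds. The same search is made on the reversed string. A cadence missed by both
searches lies between the outermost changes of character at both ends, and then there is a crossing
at one of the ends (`hasThreeCadence_iff`).

The search uses the string only through queries for the last position up to a bound with a given
character and parity (`lastPos`). For an uncompressed string, these are tabulated in linear
time. For a grammar, the length of the string derived from each nonterminal and its last position of
each character and parity are computed bottom up, and a query is a descent in the derivation tree,
with at most as many steps as there are nonterminals. The reversed string is given by the
grammar in which the two nonterminals of each pair change places.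

The programs are written in a small imperative language `Cmd`, which is compiled to the word RAM
(`Cmd.Runs.compile`) and for which total correctness with a time bound is expressed by `Cmd.Ends`.
-/

/-! ### Cadences of a colouring of the positions -/

/-- The string `s 1, …, s n` has a 3-cadence `x, y, z`, in terms of the first and the last
position: `3 x ≤ z` says that `x - d ≤ 0`, and `2 n + 2 + x ≤ 3 z` that `z + d > n`. -/
def HasThreeCadence (n : ℕ) (s : ℕ → Bool) : Prop :=
  ∃ x y z : ℕ, 0 < x ∧ x + z = 2 * y ∧ z ≤ n ∧ 3 * x ≤ z ∧ 2 * n + 2 + x ≤ 3 * z ∧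
    s x = s z ∧ s y = s z

/-- The last position `y ≤ u` of parity `q` with `s y = b`, or `0` if there is none. -/
def lastPos (s : ℕ → Bool) (b : Bool) (q u : ℕ) : ℕ :=
  Nat.findGreatest (fun y => y % 2 = q ∧ s y = b) u

theorem lastPos_le (s : ℕ → Bool) (b : Bool) (q u : ℕ) : lastPos s b q u ≤ u :=
  Nat.findGreatest_le u

theorem lastPos_spec {s : ℕ → Bool} {b : Bool} {q u : ℕ} (h : lastPos s b q u ≠ 0) :
    lastPos s b q u % 2 = q ∧ s (lastPos s b q u) = b :=
  Nat.findGreatest_of_ne_zero (P := fun y => y % 2 = q ∧ s y = b) rfl h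

theorem le_lastPos {s : ℕ → Bool} {b : Bool} {q u y : ℕ} (hy : y ≤ u) (hq : y % 2 = q)
    (hb : s y = b) : y ≤ lastPos s b q u :=
  Nat.le_findGreatest hy ⟨hq, hb⟩

theorem eq_lastPos {s : ℕ → Bool} {b : Bool} {q u r : ℕ} (h0 : r ≠ 0 → r ≤ u ∧ r % 2 = q ∧ s r = b)
    (h : ∀ y, 0 < y → y ≤ u → y % 2 = q → s y = b → y ≤ r) : r = lastPos s b q u := by
  apply le_antisymm
  · by_cases hr : r = 0
    · omega
    · obtain ⟨h1, h2, h3⟩ := h0 hr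
      exact le_lastPos h1 h2 h3
  · by_cases hl : lastPos s b q u = 0
    · omega
    · obtain ⟨h2, h3⟩ := lastPos_spec hl
      exact h _ (by omega) (lastPos_le ..) h2 h3

/-- The last position `y ≤ u` with `s y = b`, or `0` if there is none. -/
def lastPosAny (s : ℕ → Bool) (b : Bool) (u : ℕ) : ℕ :=
  max (lastPos s b 0 u) (lastPos s b 1 u)

theorem lastPosAny_le (s : ℕ → Bool) (b : Bool) (u : ℕ) : lastPosAny s b u ≤ u :=
  max_le (lastPos_le ..) (lastPos_le ..)

theorem lastPosAny_spec {s : ℕ → Bool} {b : Bool} {u : ℕ} (h : lastPosAny s b u ≠ 0) :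
    s (lastPosAny s b u) = b := by
  unfold lastPosAny at h ⊢
  rcases max_choice (lastPos s b 0 u) (lastPos s b 1 u) with h' | h' <;>
  · rw [h'] at h ⊢
    exact (lastPos_spec h).2

theorem le_lastPosAny {s : ℕ → Bool} {b : Bool} {u y : ℕ} (hy : y ≤ u) (hb : s y = b) :
    y ≤ lastPosAny s b u := by
  rcases Nat.mod_two_eq_zero_or_one y with h | h
  · exact le_max_of_le_left (le_lastPos hy h hb)
  · exact le_max_of_le_right (le_lastPos hy h hb)

/-! ### The search along one end of the string -/

/-- The last position before `t`, of the parity of `t`, whose character differs from `s t`. -/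
def lastChange (s : ℕ → Bool) (t : ℕ) : ℕ :=
  lastPos s (!s t) (t % 2) t

theorem lastChange_spec {s : ℕ → Bool} {t : ℕ} (h : lastChange s t ≠ 0) :
    lastChange s t % 2 = t % 2 ∧ s (lastChange s t) = !s t :=
  lastPos_spec h

theorem eq_of_lastChange_lt {s : ℕ → Bool} {t z : ℕ} (h : lastChange s t < z) (hz : z ≤ t)
    (hp : z % 2 = t % 2) : s z = s t := by
  by_contra hne
  have : z ≤ lastChange s t := le_lastPos hz hp (by
    cases h1 : s z <;> cases h2 : s t <;> simp_all)
  omega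

theorem lastChange_lt {s : ℕ → Bool} {t : ℕ} (ht : 0 < t) : lastChange s t < t := by
  have h1 : lastChange s t ≤ t := lastPos_le ..
  rcases h1.lt_or_eq with h | h
  · exact h
  · have := (lastChange_spec (s := s) (t := t) (by omega)).2
    rw [h] at this
    simp at this

/-- A bound on the first position `x` of a cadence whose last position is `z`. -/
def firstBound (n z : ℕ) : ℕ :=
  min (z / 3) (3 * z - 2 * n - 2)

theorem le_firstBound {n x z : ℕ} (hx : 0 < x) :
    x ≤ firstBound n z ↔ 3 * x ≤ z ∧ 2 * n + 2 + x ≤ 3 * z := by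
  unfold firstBound
  omega

/-- The last position not coloured `s t` among the possible first positions belonging to the last
position `lastChange s t`. -/
def crossingPos (n : ℕ) (s : ℕ → Bool) (t : ℕ) : ℕ :=
  lastPos s (!s t) (t % 2) (firstBound n (lastChange s t))

/-- Among the first positions that belong to `lastChange s t`, there is one with the character `s t`
before one with the other character. -/
def Crossing (n : ℕ) (s : ℕ → Bool) (t : ℕ) : Prop :=
  lastPos s (s t) (t % 2) (crossingPos n s t) ≠ 0

theorem exists_adjacent_change {s : ℕ → Bool} {b : Bool} {a k : ℕ} (ha : s a = b)
    (hk : s (a + 2 * k) ≠ b) :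
    ∃ j, j < k ∧ s (a + 2 * j) = b ∧ s (a + 2 * j + 2) ≠ b := by
  induction k with
  | zero => exact absurd ha hk
  | succ k ih =>
    by_cases h : s (a + 2 * k) = b
    · exact ⟨k, by omega, h, by simpa [mul_add, add_assoc] using hk⟩
    · obtain ⟨j, hj, h1⟩ := ih h
      exact ⟨j, by omega, h1⟩

/-- Two pairs of outer positions with the same midpoint, one pair coloured `b` and one `!b`: the
midpoint completes one of them. -/
theorem HasThreeCadence.of_crossing {n : ℕ} {s : ℕ → Bool} {b : Bool} {x z : ℕ} (hx : 0 < x)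
    (hp : x % 2 = z % 2) (h1 : s x = b) (h2 : s (x + 2) ≠ b) (h3 : s z ≠ b) (h4 : s (z + 2) = b)
    (hz : z + 2 ≤ n) (hb : x + 2 ≤ firstBound n z) : HasThreeCadence n s := by
  obtain ⟨h5, h6⟩ := (le_firstBound (by omega)).1 hb
  by_cases hm : s ((x + z + 2) / 2) = b
  · exact ⟨x, (x + z + 2) / 2, z + 2, hx, by omega, hz, by omega, by omega, by rw [h1, h4],
      by rw [hm, h4]⟩
  · refine ⟨x + 2, (x + z + 2) / 2, z, by omega, by omega, by omega, h5, by omega, ?_, ?_⟩ <;>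
    · revert h2 h3 hm
      cases s (x + 2) <;> cases s z <;> cases s ((x + z + 2) / 2) <;> cases b <;> simp

theorem Crossing.hasThreeCadence {n : ℕ} {s : ℕ → Bool} {t : ℕ} (ht : t ≤ n)
    (h : Crossing n s t) : HasThreeCadence n s := by
  set e := lastPos s (s t) (t % 2) (crossingPos n s t) with he
  have hle : e ≤ crossingPos n s t := lastPos_le ..
  obtain ⟨e2, e3⟩ := lastPos_spec h
  rw [← he] at e2 e3
  have h0 : e ≠ 0 := h
  have hc0 : crossingPos n s t ≠ 0 := by omega
  obtain ⟨c2, c3⟩ := lastPos_spec hc0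
  have c1 : crossingPos n s t ≤ firstBound n (lastChange s t) := lastPos_le ..
  change crossingPos n s t % 2 = _ at c2
  change s (crossingPos n s t) = _ at c3
  have hb := (le_firstBound (by omega)).1 c1
  obtain ⟨z2, z3⟩ := lastChange_spec (s := s) (t := t) (by omega)
  have hlt := lastChange_lt (s := s) (t := t) (by
    have : lastChange s t ≤ t := lastPos_le ..
    omega)
  obtain ⟨k, hk⟩ : ∃ k, crossingPos n s t = e + 2 * k := ⟨(crossingPos n s t - e) / 2, by omega⟩
  rw [hk] at c3 c1
  obtain ⟨j, hj, h1, h2⟩ := exists_adjacent_change e3 (k := k) (by rw [c3]; simp)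
  exact HasThreeCadence.of_crossing (b := s t) (x := e + 2 * j) (z := lastChange s t)
    (by omega) (by omega) h1 h2 (by rw [z3]; simp)
    (eq_of_lastChange_lt (by omega) (by omega) (by omega)) (by omega) (by omega)

/-- If there is no crossing, the possible first positions belonging to `lastChange s t` first
have the character `!s t` and then `s t`. -/
theorem eq_of_not_crossing {n : ℕ} {s : ℕ → Bool} {t : ℕ} (h : ¬ Crossing n s t) {x x' : ℕ}
    (hx : 0 < x) (hxx : x ≤ x') (hb : x' ≤ firstBound n (lastChange s t)) (hp : x % 2 = t % 2)
    (hp' : x' % 2 = t % 2) (hs : s x = s t) : s x' = s t := by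
  by_contra hne
  have h1 : x' ≤ crossingPos n s t := le_lastPos hb hp' (by
    revert hne; cases s x' <;> cases s t <;> simp)
  have h2 : x ≤ lastPos s (s t) (t % 2) (crossingPos n s t) := le_lastPos (by omega) hp hs
  apply h
  unfold Crossing
  omega

/-- The last possible middle position belonging to the first position `x`. -/
def midPos (s : ℕ → Bool) (t x : ℕ) : ℕ :=
  lastPosAny s (s t) ((x + t) / 2)

/-- A bound on the first positions that belong to the middle position `y` and a last position after
`lastChange s t`. -/
def midBound (n : ℕ) (s : ℕ → Bool) (t y : ℕ) : ℕ :=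
  min (min (y / 2) ((3 * y - n - 1) / 2)) (2 * y - lastChange s t - 1)

theorem le_midBound {n : ℕ} {s : ℕ → Bool} {t x y : ℕ} (hx : 0 < x) :
    x ≤ midBound n s t y ↔ 2 * x ≤ y ∧ 2 * x + n + 1 ≤ 3 * y ∧ x + lastChange s t < 2 * y := by
  unfold midBound
  omega

/-- The next first position that the search has to consider after `x`. -/
def nextPos (n : ℕ) (s : ℕ → Bool) (t x : ℕ) : ℕ :=
  lastPos s (s t) (t % 2) (midBound n s t (midPos s t x))

/-- The search for a cadence that ends after `lastChange s t`, downwards from the first position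
`x`, succeeds within `k` rounds. It alternates between first and middle positions: below the last
possible middle position for `x` coloured `s t`, it looks for the next first position. -/
def Scan (n : ℕ) (s : ℕ → Bool) (t : ℕ) : ℕ → ℕ → Prop
  | 0, _ => False
  | k + 1, x => x ≠ 0 ∧ (x ≤ midBound n s t (midPos s t x) ∨ Scan n s t k (nextPos n s t x))

/-- The search from `x` ends after at most `k` rounds. -/
def ScanEnds (n : ℕ) (s : ℕ → Bool) (t : ℕ) : ℕ → ℕ → Prop
  | 0, x => x = 0
  | k + 1, x => x = 0 ∨ x ≤ midBound n s t (midPos s t x) ∨ ScanEnds n s t k (nextPos n s t x)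

theorem nextPos_spec {n : ℕ} {s : ℕ → Bool} {t x : ℕ} (h : nextPos n s t x ≠ 0) :
    nextPos n s t x % 2 = t % 2 ∧ s (nextPos n s t x) = s t :=
  lastPos_spec h

theorem Scan.hasThreeCadence {n : ℕ} {s : ℕ → Bool} {t : ℕ} (ht : t ≤ n) {k x : ℕ}
    (hx : x ≠ 0 → x % 2 = t % 2 ∧ s x = s t) (h : Scan n s t k x) : HasThreeCadence n s := by
  induction k generalizing x with
  | zero => exact h.elim
  | succ k ih =>
    obtain ⟨h0, h | h⟩ := h
    · obtain ⟨hp, hs⟩ := hx h0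
      obtain ⟨h1, h2, h3⟩ := (le_midBound (by omega)).1 h
      have hy : midPos s t x ≤ (x + t) / 2 := lastPosAny_le ..
      have hys : s (midPos s t x) = s t := lastPosAny_spec (by
        change midPos s t x ≠ 0; omega)
      have hz : s (2 * midPos s t x - x) = s t :=
        eq_of_lastChange_lt (by omega) (by omega) (by omega)
      exact ⟨x, midPos s t x, 2 * midPos s t x - x, by omega, by omega, by omega, by omega,
        by omega, by rw [hs, hz], by rw [hys, hz]⟩
    · exact ih nextPos_spec h

theorem midBound_mono {n : ℕ} {s : ℕ → Bool} {t y y' : ℕ} (h : y ≤ y') :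
    midBound n s t y ≤ midBound n s t y' := by
  unfold midBound
  omega

/-- The search misses no cadence that ends after `lastChange s t`. -/
theorem scan_of_cadence {n : ℕ} {s : ℕ → Bool} {t x y z : ℕ} (hx : 0 < x) (hxy : x + z = 2 * y)
    (hz : z ≤ t) (hp : z % 2 = t % 2) (h1 : 3 * x ≤ z) (h2 : 2 * n + 2 + x ≤ 3 * z)
    (hc : lastChange s t < z) (hsx : s x = s t) (hsy : s y = s t) {k x' : ℕ} (hxx : x ≤ x')
    (he : ScanEnds n s t k x') : Scan n s t k x' := by
  induction k generalizing x' with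
  | zero => simp only [ScanEnds] at he; omega
  | succ k ih =>
    refine ⟨by omega, ?_⟩
    rcases he with he | he | he
    · omega
    · exact Or.inl he
    · refine Or.inr (ih ?_ he)
      have hy : y ≤ midPos s t x' := le_lastPosAny (by omega) hsy
      refine le_lastPos (le_trans ?_ (midBound_mono hy)) (by omega) hsx
      exact (le_midBound hx).2 (by omega)

/-- While the search goes on, the distance `t - 3 x` of the first position from its largest
possible value essentially doubles. -/
theorem nextPos_gap {n : ℕ} {s : ℕ → Bool} {t x : ℕ} (hn : n ≤ t + 1)
    (hcr : ¬ Crossing n s t) (hx : 0 < x) (hxt : 3 * x ≤ t) (hp : x % 2 = t % 2)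
    (hb : ¬ x ≤ midBound n s t (midPos s t x)) (hx' : nextPos n s t x ≠ 0)
    (hb' : ¬ nextPos n s t x ≤ midBound n s t (midPos s t (nextPos n s t x))) :
    2 * (t - 3 * x) ≤ t - 3 * nextPos n s t x + 3 ∨ t - 3 * nextPos n s t x ≤ 8 := by
  set x' := nextPos n s t x with hxd
  obtain ⟨p', s'⟩ := nextPos_spec hx'
  rw [← hxd] at p' s'
  set y := midPos s t x with hy
  have hle : x' ≤ midBound n s t y := lastPos_le ..
  -- otherwise `y` would also be a middle position for `x'`
  have hgt : x' + t < 2 * y := by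
    by_contra hcon
    apply hb'
    refine hle.trans (midBound_mono ?_)
    by_cases h0 : y = 0
    · omega
    · exact le_lastPosAny (by omega) (lastPosAny_spec h0)
  have hlast := lastChange_lt (s := s) (t := t) (by omega)
  have hle' := (le_midBound (by omega)).1 hle
  rw [le_midBound hx] at hb
  by_cases hX : x ≤ firstBound n (lastChange s t)
  · -- the characters from `x'` up to `x` are equal, so the bound is attained up to parity
    have hnot : ¬ x' + 2 ≤ midBound n s t y := by
      intro hcon
      have h3 : s (x' + 2) = s t := by
        refine eq_of_not_crossing hcr (x := x') (by omega) (by omega) (le_trans ?_ hX) p'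
          (by omega) s'
        have hlt : midBound n s t y < x := by
          rw [← le_midBound hx] at hb
          omega
        omega
      have : x' + 2 ≤ x' := le_lastPos hcon (by omega) h3
      omega
    rw [le_midBound (by omega)] at hnot
    omega
  · rw [le_firstBound hx] at hX
    omega

/-- The gap grows from `12` or more to `t` in at most `k` doublings. -/
theorem scanEnds_of_le {n : ℕ} {s : ℕ → Bool} {t : ℕ} (hn : n ≤ t + 1)
    (hcr : ¬ Crossing n s t) {k x : ℕ} (hx : x ≠ 0 → 3 * x ≤ t ∧ x % 2 = t % 2 ∧ 12 + 3 * x ≤ t ∧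
      t < 2 ^ k * (t - 3 * x - 3)) : ScanEnds n s t (k + 1) x := by
  induction k generalizing x with
  | zero =>
    by_cases h0 : x = 0
    · exact Or.inl h0
    · have := hx h0
      omega
  | succ k ih =>
    by_cases h0 : x = 0
    · exact Or.inl h0
    obtain ⟨h1, h2, h3, h4⟩ := hx h0
    by_cases hb : x ≤ midBound n s t (midPos s t x)
    · exact Or.inr (Or.inl hb)
    refine Or.inr (Or.inr ?_)
    by_cases hb' : nextPos n s t x ≤ midBound n s t (midPos s t (nextPos n s t x))
    · exact Or.inr (Or.inl hb')
    apply ih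
    intro hne
    have hg := nextPos_gap hn hcr (by omega) h1 h2 hb hne hb'
    have hp := (nextPos_spec hne).1
    have hlt : nextPos n s t x < x := by
      have : nextPos n s t x ≤ midBound n s t (midPos s t x) := lastPos_le ..
      omega
    refine ⟨by omega, hp, by omega, lt_of_lt_of_le h4 ?_⟩
    rw [pow_succ, mul_assoc]
    exact Nat.mul_le_mul_left _ (by omega)

theorem scanEnds_succ {n : ℕ} {s : ℕ → Bool} {t k x : ℕ}
    (h : x ≠ 0 → ¬ x ≤ midBound n s t (midPos s t x) → ScanEnds n s t k (nextPos n s t x)) :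
    ScanEnds n s t (k + 1) x := by
  by_cases h0 : x = 0
  · exact Or.inl h0
  · by_cases hb : x ≤ midBound n s t (midPos s t x)
    · exact Or.inr (Or.inl hb)
    · exact Or.inr (Or.inr (h h0 hb))

/-- The first position from which the search starts. -/
def startPos (n : ℕ) (s : ℕ → Bool) (t : ℕ) : ℕ :=
  lastPos s (s t) (t % 2) (firstBound n t)

theorem scanEnds_startPos {n : ℕ} {s : ℕ → Bool} {t k : ℕ} (hn : n ≤ t + 1) (hk : t < 2 ^ k)
    (hcr : ¬ Crossing n s t) : ScanEnds n s t (k + 3) (startPos n s t) := by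
  have hlt : ∀ x, ¬ x ≤ midBound n s t (midPos s t x) → nextPos n s t x < x := by
    intro x hx
    have : nextPos n s t x ≤ midBound n s t (midPos s t x) := lastPos_le ..
    omega
  -- after two rounds the gap is at least `12`, as positions of equal parity differ by `2`
  apply scanEnds_succ
  intro h0 hb
  have hle : startPos n s t ≤ firstBound n t := lastPos_le ..
  have h1 := (le_firstBound (by omega)).1 hle
  have hp : startPos n s t % 2 = t % 2 := (lastPos_spec h0).1
  have l1 := hlt _ hb
  apply scanEnds_succ
  intro h0' hb'
  have l2 := hlt _ hb'
  have hp' := (nextPos_spec h0').1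
  apply scanEnds_of_le hn hcr
  intro h0''
  have hp'' := (nextPos_spec h0'').1
  refine ⟨by omega, hp'', by omega, lt_of_lt_of_le hk ?_⟩
  exact Nat.le_mul_of_pos_right _ (by omega)

/-! ### Both ends of the string -/

/-- The search among the last positions up to `t` of the parity of `t` finds a cadence. -/
def Detects (n : ℕ) (s : ℕ → Bool) (k t : ℕ) : Prop :=
  0 < t ∧ (Crossing n s t ∨ Scan n s t k (startPos n s t))

theorem Detects.hasThreeCadence {n : ℕ} {s : ℕ → Bool} {k t : ℕ} (ht : t ≤ n)
    (h : Detects n s k t) : HasThreeCadence n s := by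
  obtain ⟨-, h | h⟩ := h
  · exact h.hasThreeCadence ht
  · exact h.hasThreeCadence ht lastPos_spec

/-- The string `s 1, …, s n` read backwards. -/
def revPos (n : ℕ) (s : ℕ → Bool) : ℕ → Bool :=
  fun i => s (n + 1 - i)

theorem HasThreeCadence.of_revPos {n : ℕ} {s : ℕ → Bool} (h : HasThreeCadence n (revPos n s)) :
    HasThreeCadence n s := by
  obtain ⟨x, y, z, h1, h2, h3, h4, h5, h6, h7⟩ := h
  exact ⟨n + 1 - z, n + 1 - y, n + 1 - x, by omega, by omega, by omega, by omega, by omega,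
    h6.symm, h7.trans h6.symm⟩

/-- A cadence that the search along the right end misses ends at or before `lastChange s t`. -/
theorem le_lastChange_of_not_detects {n : ℕ} {s : ℕ → Bool} {k t x y z : ℕ} (hk : t < 2 ^ k)
    (hn : n ≤ t + 1) (h : ¬ Detects n s (k + 3) t) (hx : 0 < x) (hxy : x + z = 2 * y)
    (hz : z ≤ t) (hp : z % 2 = t % 2) (h1 : 3 * x ≤ z) (h2 : 2 * n + 2 + x ≤ 3 * z)
    (hsx : s x = s z) (hsy : s y = s z) : z ≤ lastChange s t := by
  by_contra hc
  apply h
  refine ⟨by omega, or_iff_not_imp_left.2 fun hcr => ?_⟩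
  have hsz : s z = s t := eq_of_lastChange_lt (by omega) hz hp
  refine scan_of_cadence hx hxy hz hp h1 h2 (by omega) (hsx.trans hsz) (hsy.trans hsz) ?_
    (scanEnds_startPos hn hk hcr)
  exact le_lastPos ((le_firstBound hx).2 (by omega)) (by omega) (hsx.trans hsz)

/-- The searches along the two ends together find a cadence if there is one: a cadence missed by
both lies inside the outermost changes of character at both ends, and these changes then have
a crossing at one of the ends. -/
theorem hasThreeCadence_iff {n k : ℕ} {s : ℕ → Bool} (hk : n < 2 ^ k) :
    HasThreeCadence n s ↔
      ((Detects n s (k + 3) n ∨ Detects n s (k + 3) (n - 1)) ∨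
        (Detects n (revPos n s) (k + 3) n ∨ Detects n (revPos n s) (k + 3) (n - 1))) := by
  constructor
  · rintro ⟨x, y, z, hx, hxy, hz, h1, h2, hsx, hsy⟩
    by_contra hcon
    simp only [not_or] at hcon
    obtain ⟨⟨hn0, hn1⟩, hr0, hr1⟩ := hcon
    obtain ⟨t, ht, htp, hd⟩ : ∃ t, (t = n ∨ t = n - 1) ∧ z % 2 = t % 2 ∧
        ¬ Detects n s (k + 3) t := by
      by_cases hp : z % 2 = n % 2
      · exact ⟨n, by omega, hp, hn0⟩
      · exact ⟨n - 1, by omega, by omega, hn1⟩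
    obtain ⟨r, hr, hrp, hd'⟩ : ∃ r, (r = n ∨ r = n - 1) ∧ (n + 1 - x) % 2 = r % 2 ∧
        ¬ Detects n (revPos n s) (k + 3) r := by
      by_cases hp : (n + 1 - x) % 2 = n % 2
      · exact ⟨n, by omega, hp, hr0⟩
      · exact ⟨n - 1, by omega, by omega, hr1⟩
    have hzc := le_lastChange_of_not_detects (by omega) (by omega) hd hx hxy (by omega) htp h1 h2
      hsx hsy
    have hxc := le_lastChange_of_not_detects (x := n + 1 - z) (y := n + 1 - y) (z := n + 1 - x)
      (by omega) (by omega) hd' (by omega) (by omega) (by omega) hrp (by omega) (by omega)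
      (by simp only [revPos, show n + 1 - (n + 1 - z) = z by omega,
            show n + 1 - (n + 1 - x) = x by omega, hsx])
      (by simp only [revPos, show n + 1 - (n + 1 - y) = y by omega,
            show n + 1 - (n + 1 - x) = x by omega, hsx, hsy])
    have hcr : ¬ Crossing n s t := fun h => hd ⟨by omega, Or.inl h⟩
    have hcr' : ¬ Crossing n (revPos n s) r := fun h => hd' ⟨by omega, Or.inl h⟩
    -- the changes of character at the right and at the left end
    obtain ⟨c1, c2⟩ := lastChange_spec (s := s) (t := t) (by omega)
    obtain ⟨d1, d2⟩ := lastChange_spec (s := revPos n s) (t := r) (by omega)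
    have cle : lastChange s t ≤ t := lastPos_le ..
    have dle := lastChange_lt (s := revPos n s) (t := r) (by omega)
    set c := lastChange s t
    set d := lastChange (revPos n s) r with hd0
    simp only [revPos] at d2
    have key := @eq_of_not_crossing n s t hcr
    have key' := @eq_of_not_crossing n (revPos n s) r hcr'
    -- with equal characters at both ends, the change at the left end would make a crossing
    have e1 : s (n + 1 - r) ≠ s t := by
      intro he
      have := key (x := n + 1 - r) (x' := n + 1 - d) (by omega) (by omega)
        ((le_firstBound (by omega)).2 (by omega)) (by omega) (by omega) he
      rw [d2, he] at this
      simp at this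
    have e2 : s (n + 1 - d) = s t := by
      rw [d2]
      revert e1
      cases s (n + 1 - r) <;> cases s t <;> simp
    have e3 : s x = s t := key (x := n + 1 - d) (by omega) (by omega)
        ((le_firstBound (by omega)).2 (by omega)) (by omega) (by omega) e2
    have e4 : s z = s (n + 1 - r) := by
      have := key' (x := n + 1 - c) (x' := n + 1 - z) (by omega) (by omega)
        ((le_firstBound (by omega)).2 (by omega)) (by omega) (by omega)
        (by
          simp only [revPos, show n + 1 - (n + 1 - c) = c by omega, c2]
          revert e1
          cases s (n + 1 - r) <;> cases s t <;> simp)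
      simpa only [revPos, show n + 1 - (n + 1 - z) = z by omega] using this
    exact e1 (by rw [← e4, ← hsx, e3])
  · rintro ((h | h) | (h | h))
    · exact h.hasThreeCadence le_rfl
    · exact h.hasThreeCadence (by omega)
    · exact (h.hasThreeCadence le_rfl).of_revPos
    · exact (h.hasThreeCadence (by omega)).of_revPos

/-! ### A small imperative language for the word RAM -/

/-- The variables of the programs below: the answer `out`, which first holds the length of the
input; the length `len` of the string and the number `num` of nonterminals; `top`, `col`, `chg`,
`pos` and `mid` for `t`, `s t`, `lastChange s t`, the first and the middle position in the search;
the arguments `argB`, `argQ`, `argU` and the result `res` of a query for `lastPos`; and local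
variables of the subroutines. -/
inductive Var where
  | out | len | num | top | col | chg | pos | mid | argB | argQ | argU | res
  | cnt | nod | off | rem | lft | rgt | wid | val | go
  deriving DecidableEq

namespace Var

/-- The register that holds a variable. In particular, `out` is register `0`. -/
def idx : Var → ℕ
  | out => 0 | len => 1 | num => 2 | top => 3 | col => 4 | chg => 5 | pos => 6 | mid => 7
  | argB => 8 | argQ => 9 | argU => 10 | res => 11 | cnt => 12 | nod => 13 | off => 14
  | rem => 15 | lft => 16 | rgt => 17 | wid => 18 | val => 19 | go => 20

theorem idx_lt (v : Var) : v.idx < 32 := by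
  cases v <;> decide

theorem idx_injective : Function.Injective idx := by
  intro u v h
  cases u <;> cases v <;> first | rfl | exact absurd h (by decide)

end Var

/-- The values of the variables and of the memory. -/
structure Env where
  reg : Var → ℕ
  mem : ℕ → ℕ

namespace Env

/-- Change the value of a variable. -/
def set (s : Env) (v : Var) (c : ℕ) : Env :=
  ⟨Function.update s.reg v c, s.mem⟩

/-- Change the contents of a memory cell. -/
def write (s : Env) (a c : ℕ) : Env :=
  ⟨s.reg, Function.update s.mem a c⟩

@[simp] theorem set_reg (s : Env) (u v : Var) (c : ℕ) :
    (s.set v c).reg u = if u = v then c else s.reg u := by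
  simp [set, Function.update_apply]

@[simp] theorem set_mem (s : Env) (v : Var) (c : ℕ) : (s.set v c).mem = s.mem := rfl

@[simp] theorem write_reg (s : Env) (a c : ℕ) : (s.write a c).reg = s.reg := rfl

@[simp] theorem write_mem (s : Env) (a c : ℕ) :
    (s.write a c).mem = Function.update s.mem a c := rfl

end Env

/-- Expressions. -/
inductive Expr where
  | var (v : Var) | lit (c : ℕ) | op (o : WordOp) (a b : Expr) | load (a : Expr)

/-- The value of a variable. -/
prefix:max "♮" => Expr.var

namespace Expr

instance : Add Expr := ⟨op .add⟩
instance : Sub Expr := ⟨op .sub⟩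
instance : Mul Expr := ⟨op .mul⟩
instance : Div Expr := ⟨op .div⟩
instance : Mod Expr := ⟨op .mod⟩
instance (n : ℕ) : OfNat Expr n := ⟨lit n⟩

/-- The value of an expression. -/
def eval (s : Env) : Expr → ℕ
  | var v => s.reg v
  | lit c => c
  | op o a b => o.eval (a.eval s) (b.eval s)
  | load a => s.mem (a.eval s)

/-- The evaluation of an expression produces only words of length `w`. -/
def Fits (w : ℕ) (s : Env) : Expr → Prop
  | var v => s.reg v < 2 ^ w
  | lit c => c < 2 ^ w
  | op o a b => a.Fits w s ∧ b.Fits w s ∧ o.eval (a.eval s) (b.eval s) < 2 ^ w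
  | load a => a.Fits w s ∧ s.mem (a.eval s) < 2 ^ w

/-- The number of steps of the evaluation of an expression. -/
def cost : Expr → ℕ
  | var _ => 2
  | lit _ => 1
  | op _ a b => a.cost + b.cost + 1
  | load a => a.cost + 1

/-- Evaluate an expression into register `k`, with the help of the registers after `k`. -/
def compile (k : ℕ) : Expr → RamProgram
  | var v => .seq (.const k 0) (.op .add k v.idx k)
  | lit c => .const k c
  | op o a b => .seq (.seq (a.compile k) (b.compile (k + 1))) (.op o k k (k + 1))
  | load a => .seq (a.compile k) (.load k k)

/-- `1` if `a < b`, else `0`. -/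
def lt (a b : Expr) : Expr := op .lt a b

/-- `1` if `a = b`, else `0`. -/
def equal (a b : Expr) : Expr := op .eq a b

/-- The minimum, by truncated subtraction. -/
def minimum (a b : Expr) : Expr := a - (a - b)

theorem add_def (a b : Expr) : a + b = op .add a b := rfl
theorem sub_def (a b : Expr) : a - b = op .sub a b := rfl
theorem mul_def (a b : Expr) : a * b = op .mul a b := rfl
theorem div_def (a b : Expr) : a / b = op .div a b := rfl
theorem mod_def (a b : Expr) : a % b = op .mod a b := rfl
theorem ofNat_def (n : ℕ) : (OfNat.ofNat n : Expr) = lit n := rfl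

end Expr

/-- The registers and the memory of the machine hold the values of an environment. -/
def Env.Holds (s : Env) (σ : RamState) : Prop :=
  (∀ v : Var, σ.reg v.idx = s.reg v) ∧ σ.mem = s.mem

theorem Env.Holds.of_eq {s : Env} {σ τ : RamState} (h : s.Holds σ)
    (hr : ∀ r, r < 32 → τ.reg r = σ.reg r) (hm : τ.mem = σ.mem) : s.Holds τ :=
  ⟨fun v => (hr _ v.idx_lt).trans (h.1 v), hm.trans h.2⟩

theorem Expr.compile_runs {w : ℕ} {s : Env} (e : Expr) {k : ℕ} (hk : 32 ≤ k) {σ : RamState}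
    (hσ : s.Holds σ) (he : e.Fits w s) :
    ∃ τ, (e.compile k).Runs w σ τ e.cost ∧ τ.reg k = e.eval s ∧
      (∀ r, r < k → τ.reg r = σ.reg r) ∧ τ.mem = σ.mem := by
  induction e generalizing k σ with
  | var v =>
    have hv := v.idx_lt
    simp only [Fits] at he
    refine ⟨_, .seq (.const _ _ _ (Nat.two_pow_pos w)) (.op _ _ _ _ _ ?_), ?_, ?_, rfl⟩
    · simpa [WordOp.eval, Function.update_apply, show v.idx ≠ k by omega, hσ.1] using he
    · simp [WordOp.eval, eval, show v.idx ≠ k by omega, hσ.1]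
    · intro r hr
      simp [show r ≠ k by omega]
  | lit c =>
    refine ⟨_, .const _ _ _ he, ?_, ?_, rfl⟩
    · simp [eval]
    · intro r hr
      simp [show r ≠ k by omega]
  | op o a b iha ihb =>
    obtain ⟨ha, hb, ho⟩ := he
    obtain ⟨τ, h1, h2, h3, h4⟩ := iha hk hσ ha
    obtain ⟨ρ, g1, g2, g3, g4⟩ := ihb (k := k + 1) (by omega)
      (hσ.of_eq (fun r hr => h3 r (by omega)) h4) hb
    have hk' : ρ.reg k = a.eval s := by rw [g3 k (by omega), h2]
    refine ⟨_, .seq (.seq h1 g1) (.op _ _ _ _ _ ?_), ?_, ?_, ?_⟩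
    · rw [hk', g2]; exact ho
    · simp [eval, hk', g2]
    · intro r hr
      simp [show r ≠ k by omega, g3 r (by omega), h3 r hr]
    · exact g4.trans h4
  | load a iha =>
    obtain ⟨ha, ho⟩ := he
    obtain ⟨τ, h1, h2, h3, h4⟩ := iha hk hσ ha
    refine ⟨_, .seq h1 (.load _ _ _ ?_), ?_, ?_, h4⟩
    · rw [h2, h4, hσ.2]; exact ho
    · simp [eval, h2, h4, hσ.2]
    · intro r hr
      simp [show r ≠ k by omega, h3 r hr]

/-- Commands. -/
inductive Cmd where
  | skip
  | assign (v : Var) (e : Expr)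
  | store (a e : Expr)
  | seq (P Q : Cmd)
  | ite (e : Expr) (P Q : Cmd)
  | loop (v : Var) (P : Cmd)

namespace Cmd

/-- First `P`, then `Q`. -/
infixr:60 " ;; " => Cmd.seq
/-- Assign the value of `e` to the variable `v`. -/
infix:62 " ::= " => Cmd.assign

/-- The RAM program of a command; the registers from `32` on are scratch space. -/
def compile : Cmd → RamProgram
  | skip => .skip
  | assign v e => .seq (e.compile 32) (.seq (.const v.idx 0) (.op .add v.idx v.idx 32))
  | store a e => .seq (.seq (a.compile 32) (e.compile 33)) (.store 32 33)
  | seq P Q => .seq P.compile Q.compile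
  | ite e P Q => .seq (e.compile 32) (.ite 32 P.compile Q.compile)
  | loop v P => .loop v.idx P.compile

/-- The semantics of commands: `c.Runs w s s' t` says that `c` leads from `s` to `s'` in
`t` steps. -/
inductive Runs (w : ℕ) : Cmd → Env → Env → ℕ → Prop where
  | skip (s : Env) : Runs w .skip s s 1
  | assign {s : Env} {v : Var} {e : Expr} (h : e.Fits w s) :
      Runs w (.assign v e) s (s.set v (e.eval s)) (e.cost + 2)
  | store {s : Env} {a e : Expr} (ha : a.Fits w s) (he : e.Fits w s) :
      Runs w (.store a e) s (s.write (a.eval s) (e.eval s)) (a.cost + e.cost + 1)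
  | seq {P Q : Cmd} {s s' s'' : Env} {t t' : ℕ} (hP : Runs w P s s' t)
      (hQ : Runs w Q s' s'' t') : Runs w (.seq P Q) s s'' (t + t')
  | ite_true {e : Expr} {P Q : Cmd} {s s' : Env} {t : ℕ} (he : e.Fits w s) (h : e.eval s ≠ 0)
      (hP : Runs w P s s' t) : Runs w (.ite e P Q) s s' (e.cost + (t + 1))
  | ite_false {e : Expr} {P Q : Cmd} {s s' : Env} {t : ℕ} (he : e.Fits w s) (h : e.eval s = 0)
      (hQ : Runs w Q s s' t) : Runs w (.ite e P Q) s s' (e.cost + (t + 1))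
  | loop_exit {v : Var} {P : Cmd} {s : Env} (h : s.reg v = 0) : Runs w (.loop v P) s s 1
  | loop_step {v : Var} {P : Cmd} {s s' s'' : Env} {t t' : ℕ} (h : s.reg v ≠ 0)
      (hP : Runs w P s s' t) (hl : Runs w (.loop v P) s' s'' t') :
      Runs w (.loop v P) s s'' (t + t' + 1)

theorem _root_.Expr.Fits.eval_lt {w : ℕ} {s : Env} {e : Expr} (h : e.Fits w s) :
    e.eval s < 2 ^ w := by
  cases e with
  | var v => exact h
  | lit c => exact h
  | op o a b => exact h.2.2
  | load a => exact h.2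

theorem Runs.compile {w : ℕ} {c : Cmd} {s s' : Env} {t : ℕ} (h : c.Runs w s s' t)
    {σ : RamState} (hσ : s.Holds σ) : ∃ τ, c.compile.Runs w σ τ t ∧ s'.Holds τ := by
  induction h generalizing σ with
  | skip s => exact ⟨σ, .skip σ, hσ⟩
  | @assign s v e h =>
    obtain ⟨τ, h1, h2, h3, h4⟩ := e.compile_runs le_rfl hσ h
    have hv := v.idx_lt
    refine ⟨_, .seq h1 (.seq (.const _ _ _ (Nat.two_pow_pos w)) (.op _ _ _ _ _ ?_)), ?_, ?_⟩
    · simpa [WordOp.eval, Function.update_apply, show (32 : ℕ) ≠ v.idx by omega, h2] using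
        h.eval_lt
    · intro u
      by_cases hu : u = v
      · simp [hu, WordOp.eval, Function.update_apply, show (32 : ℕ) ≠ v.idx by omega, h2]
      · have : u.idx ≠ v.idx := fun h => hu (Var.idx_injective h)
        simp [hu, this, h3 _ u.idx_lt, hσ.1]
    · simpa using h4.trans hσ.2
  | @store s a e ha he =>
    obtain ⟨τ, h1, h2, h3, h4⟩ := a.compile_runs le_rfl hσ ha
    obtain ⟨ρ, g1, g2, g3, g4⟩ := e.compile_runs (k := 33) (by omega) (hσ.of_eq h3 h4) he
    refine ⟨_, .seq (.seq h1 g1) (.store _ _ _ ?_), ?_, ?_⟩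
    · rw [g2]; exact he.eval_lt
    · intro u
      have hu := u.idx_lt
      simp [g3 u.idx (by omega), h3 _ hu, hσ.1]
    · simp [g3 32 (by omega), h2, g2, g4, h4, hσ.2]
  | seq _ _ ih1 ih2 =>
    obtain ⟨τ, h1, h2⟩ := ih1 hσ
    obtain ⟨ρ, h3, h4⟩ := ih2 h2
    exact ⟨ρ, .seq h1 h3, h4⟩
  | ite_true he h _ ih =>
    obtain ⟨τ, h1, h2, h3, h4⟩ := Expr.compile_runs _ le_rfl hσ he
    obtain ⟨ρ, g1, g2⟩ := ih (hσ.of_eq h3 h4)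
    exact ⟨ρ, .seq h1 (.ite_true (by rw [h2]; exact h) g1), g2⟩
  | ite_false he h _ ih =>
    obtain ⟨τ, h1, h2, h3, h4⟩ := Expr.compile_runs _ le_rfl hσ he
    obtain ⟨ρ, g1, g2⟩ := ih (hσ.of_eq h3 h4)
    exact ⟨ρ, .seq h1 (.ite_false (by rw [h2]; exact h) g1), g2⟩
  | loop_exit h => exact ⟨σ, .loop_exit (by rw [hσ.1]; exact h), hσ⟩
  | loop_step h _ _ ih1 ih2 =>
    obtain ⟨τ, h1, h2⟩ := ih1 hσ
    obtain ⟨ρ, h3, h4⟩ := ih2 h2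
    exact ⟨ρ, .loop_step (by rw [hσ.1]; exact h) h1 h3, h4⟩

/-! ### Total correctness with a time bound -/

/-- With `T` steps at its disposal, `c` leads from `s` to an environment that satisfies, together
with the number of steps left over, the condition `Q`. -/
def Ends (w : ℕ) (c : Cmd) (s : Env) (T : ℕ) (Q : Env → ℕ → Prop) : Prop :=
  ∃ s' t, c.Runs w s s' t ∧ t ≤ T ∧ Q s' (T - t)

variable {w : ℕ} {s : Env} {T : ℕ} {Q : Env → ℕ → Prop}

theorem ends_skip : Ends w skip s T Q ↔ 1 ≤ T ∧ Q s (T - 1) := by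
  constructor
  · rintro ⟨s', t, h, h1, h2⟩
    cases h
    exact ⟨h1, h2⟩
  · rintro ⟨h1, h2⟩
    exact ⟨_, _, .skip s, h1, h2⟩

theorem ends_assign {v : Var} {e : Expr} : Ends w (v ::= e) s T Q ↔
    e.Fits w s ∧ e.cost + 2 ≤ T ∧ Q (s.set v (e.eval s)) (T - (e.cost + 2)) := by
  constructor
  · rintro ⟨s', t, h, h1, h2⟩
    cases h
    exact ⟨‹_›, h1, h2⟩
  · rintro ⟨h, h1, h2⟩
    exact ⟨_, _, .assign h, h1, h2⟩

theorem ends_store {a e : Expr} : Ends w (store a e) s T Q ↔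
    a.Fits w s ∧ e.Fits w s ∧ a.cost + e.cost + 1 ≤ T ∧
      Q (s.write (a.eval s) (e.eval s)) (T - (a.cost + e.cost + 1)) := by
  constructor
  · rintro ⟨s', t, h, h1, h2⟩
    cases h
    exact ⟨‹_›, ‹_›, h1, h2⟩
  · rintro ⟨h, h', h1, h2⟩
    exact ⟨_, _, .store h h', h1, h2⟩

theorem ends_seq {P R : Cmd} : Ends w (P ;; R) s T Q ↔
    Ends w P s T (fun s' T' => Ends w R s' T' Q) := by
  constructor
  · rintro ⟨s', t, h, h1, h2⟩
    cases h with
    | @seq _ _ _ s1 _ t1 t2 hP hQ =>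
      exact ⟨s1, t1, hP, by omega, _, t2, hQ, by omega, by rwa [Nat.sub_sub]⟩
  · rintro ⟨s1, t1, hP, h1, s2, t2, hQ, h2, h3⟩
    exact ⟨s2, _, .seq hP hQ, by omega, by rwa [← Nat.sub_sub]⟩

theorem ends_ite {e : Expr} {P R : Cmd} : Ends w (ite e P R) s T Q ↔
    e.Fits w s ∧ e.cost + 1 ≤ T ∧ (e.eval s ≠ 0 → Ends w P s (T - (e.cost + 1)) Q) ∧
      (e.eval s = 0 → Ends w R s (T - (e.cost + 1)) Q) := by
  constructor
  · rintro ⟨s', t, h, h1, h2⟩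
    cases h with
    | @ite_true _ _ _ _ _ t he h hP =>
      exact ⟨he, by omega, fun _ => ⟨s', t, hP, by omega, by
        rwa [show T - (e.cost + 1) - t = T - (e.cost + (t + 1)) by omega]⟩, fun h' => absurd h' h⟩
    | @ite_false _ _ _ _ _ t he h hP =>
      exact ⟨he, by omega, fun h' => absurd h h', fun _ => ⟨s', t, hP, by omega, by
        rwa [show T - (e.cost + 1) - t = T - (e.cost + (t + 1)) by omega]⟩⟩
  · rintro ⟨he, h1, hP, hR⟩
    by_cases h : e.eval s = 0
    · obtain ⟨s', t, h2, h3, h4⟩ := hR h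
      exact ⟨s', _, .ite_false he h h2, by omega, by
        rwa [show T - (e.cost + 1) - t = T - (e.cost + (t + 1)) by omega] at h4⟩
    · obtain ⟨s', t, h2, h3, h4⟩ := hP h
      exact ⟨s', _, .ite_true he h h2, by omega, by
        rwa [show T - (e.cost + 1) - t = T - (e.cost + (t + 1)) by omega] at h4⟩

theorem Ends.mono {c : Cmd} {T' : ℕ} {Q' : Env → ℕ → Prop} (h : Ends w c s T' Q') (hT : T' ≤ T)
    (hQ : ∀ s' t t', Q' s' t → t' + T' = t + T → Q s' t') : Ends w c s T Q := by
  obtain ⟨s', t, h1, h2, h3⟩ := h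
  exact ⟨s', t, h1, by omega, hQ _ _ _ h3 (by omega)⟩

/-- A loop ends in at most `k` rounds of at most `B` steps if it has an invariant, indexed by a
bound on the number of remaining rounds. -/
theorem ends_loop {v : Var} {P : Cmd} (I : ℕ → Env → Prop) (B : ℕ) {k : ℕ} (h : I k s)
    (hstep : ∀ k s, I k s → s.reg v ≠ 0 →
      ∃ k', k = k' + 1 ∧ Ends w P s B (fun s' _ => I k' s')) :
    Ends w (loop v P) s (k * (B + 1) + 1) (fun s' _ => (∃ k', I k' s') ∧ s'.reg v = 0) := by
  induction k generalizing s with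
  | zero =>
    by_cases h0 : s.reg v = 0
    · exact ⟨s, 1, .loop_exit h0, by omega, ⟨_, h⟩, h0⟩
    · obtain ⟨k', hk, -⟩ := hstep _ _ h h0
      omega
  | succ k ih =>
    by_cases h0 : s.reg v = 0
    · exact ⟨s, 1, .loop_exit h0, by omega, ⟨_, h⟩, h0⟩
    · obtain ⟨k', hk, s', t, h1, h2, h3⟩ := hstep _ _ h h0
      obtain rfl : k = k' := by omega
      obtain ⟨s'', t', h4, h5, h6⟩ := ih h3
      exact ⟨s'', _, .loop_step h0 h1 h4, by rw [Nat.succ_mul]; omega, h6⟩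

attribute [irreducible] Ends

end Cmd

/-! ### The search as a program -/

namespace Var

/-- The variables that a subroutine for `lastPos` may change. -/
def isScratch : Var → Bool
  | res | nod | off | rem | lft | rgt | val | go => true
  | _ => false

end Var

/-- Replace the values of the scratch variables. -/
def Env.havoc (s : Env) (f : Var → ℕ) : Env :=
  ⟨fun v => if v.isScratch then f v else s.reg v, s.mem⟩

@[simp] theorem Env.havoc_reg (s : Env) (f : Var → ℕ) (v : Var) :
    (s.havoc f).reg v = if v.isScratch then f v else s.reg v := rfl

@[simp] theorem Env.havoc_mem (s : Env) (f : Var → ℕ) : (s.havoc f).mem = s.mem := rfl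

namespace Cmd

/-- With memory contents `μ` and the value `m` of the variable `num`, the subroutine `pr`
computes `lastPos` for the string `s 1, …, s n` in at most `B` steps. -/
def ComputesLastPos (w : ℕ) (pr : Cmd) (B : ℕ) (μ : ℕ → ℕ) (m n : ℕ) (s : ℕ → Bool) : Prop :=
  ∀ (σ : Env) (b : Bool), σ.mem = μ → σ.reg .num = m → σ.reg .len = n →
    σ.reg .argB = b.toNat → σ.reg .argQ < 2 → σ.reg .argU ≤ n →
    Ends w pr σ B fun τ _ =>
      ∃ f : Var → ℕ, τ = σ.havoc f ∧ f .res = lastPos s b (σ.reg .argQ) (σ.reg .argU)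

open Expr Var

/-- `firstBound`, for the last position `z`. -/
def firstBoundExpr (z : Expr) : Expr :=
  minimum (z / 3) (3 * z - 2 * ♮len - 2)

/-- `midBound` for the middle position in the variable `mid`. -/
def midBoundExpr : Expr :=
  minimum (minimum (♮mid / 2) ((3 * ♮mid - ♮len - 1) / 2)) (2 * ♮mid - ♮chg - 1)

/-- One round of `Scan`; a success sets `out` and ends the loop by clearing `pos`. -/
def scanBody (pr : Cmd) : Cmd :=
  argQ ::= 0 ;; argU ::= (♮pos + ♮top) / 2 ;; pr ;; mid ::= ♮res ;;
  argQ ::= 1 ;; pr ;; mid ::= ♮mid + (♮res - ♮mid) ;;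
  argQ ::= ♮top % 2 ;; argU ::= midBoundExpr ;;
  ite (lt ♮argU ♮pos) (pr ;; pos ::= ♮res) (out ::= 1 ;; pos ::= 0)

/-- The first part of the search: determine `lastChange` and look for a crossing. -/
def crossingTest (pr : Cmd) : Cmd :=
  argB ::= 1 ;; argQ ::= ♮top % 2 ;; argU ::= ♮top ;; pr ;; col ::= equal ♮res ♮top ;;
  argB ::= 1 - ♮col ;; pr ;; chg ::= ♮res ;;
  argU ::= firstBoundExpr ♮chg ;; pr ;;
  argB ::= ♮col ;; argU ::= ♮res ;; pr

/-- The search for cadences whose last position has the parity of the variable `top` and is at most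
`top`; a success is reported by setting `out`. -/
def detect (pr : Cmd) : Cmd :=
  ite ♮top
    (crossingTest pr ;;
      ite ♮res (out ::= 1)
        (argU ::= firstBoundExpr ♮top ;; pr ;; pos ::= ♮res ;; loop pos (scanBody pr)))
    skip

theorem ComputesLastPos.ends {w : ℕ} {pr : Cmd} {B : ℕ} {μ : ℕ → ℕ} {m n : ℕ} {s : ℕ → Bool}
    (h : ComputesLastPos w pr B μ m n s) {σ : Env} {T : ℕ} {Q : Env → ℕ → Prop} (b : Bool)
    (hσ : σ.mem = μ ∧ σ.reg num = m ∧ σ.reg len = n ∧ σ.reg argB = b.toNat ∧ σ.reg argQ < 2 ∧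
      σ.reg argU ≤ n ∧ B ≤ T)
    (hQ : ∀ f : Var → ℕ, f res = lastPos s b (σ.reg argQ) (σ.reg argU) → f res ≤ σ.reg argU →
      ∀ T', T ≤ T' + B → Q (σ.havoc f) T') : Ends w pr σ T Q := by
  obtain ⟨h1, h2, h3, h4, h5, h6, h7⟩ := hσ
  refine (h σ b h1 h2 h3 h4 h5 h6).mono h7 ?_
  rintro _ t t' ⟨f, rfl, hf⟩ ht
  exact hQ f hf (hf ▸ lastPos_le ..) t' (by omega)

theorem scanBody_ends {w : ℕ} {pr : Cmd} {B : ℕ} {μ : ℕ → ℕ} {m n : ℕ} {s : ℕ → Bool}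
    (h : ComputesLastPos w pr B μ m n s) (hw : 10 * n + 20 < 2 ^ w) {t : ℕ} (ht : t ≤ n) {σ : Env}
    (hμ : σ.mem = μ) (hm : σ.reg num = m) (hn : σ.reg len = n) (hb : σ.reg argB = (s t).toNat)
    (htop : σ.reg top = t) (hchg : σ.reg chg = lastChange s t) (hpos : σ.reg pos ≤ n) :
    Ends w (scanBody pr) σ (3 * B + 200) fun τ _ =>
      τ.mem = μ ∧ τ.reg num = m ∧ τ.reg len = n ∧ τ.reg argB = (s t).toNat ∧ τ.reg top = t ∧
      τ.reg chg = lastChange s t ∧ τ.reg pos ≤ n ∧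
      if σ.reg pos ≤ midBound n s t (midPos s t (σ.reg pos)) then
        τ.reg out = 1 ∧ τ.reg pos = 0
      else τ.reg out = σ.reg out ∧ τ.reg pos = nextPos n s t (σ.reg pos) := by
  have hw0 : w ≠ 0 := by
    rintro rfl
    omega
  have hc : lastChange s t ≤ t := lastPos_le ..
  have hy : midPos s t (σ.reg pos) ≤ (σ.reg pos + t) / 2 := lastPosAny_le ..
  have hm' : midPos s t (σ.reg pos) = max (lastPos s (s t) 0 ((σ.reg pos + t) / 2))
      (lastPos s (s t) 1 ((σ.reg pos + t) / 2)) := rfl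
  have hb' : midBound n s t (midPos s t (σ.reg pos)) = min (min (midPos s t (σ.reg pos) / 2)
      ((3 * midPos s t (σ.reg pos) - n - 1) / 2))
      (2 * midPos s t (σ.reg pos) - lastChange s t - 1) := rfl
  have hx : nextPos n s t (σ.reg pos) = lastPos s (s t) (t % 2)
      (midBound n s t (midPos s t (σ.reg pos))) := rfl
  generalize midPos s t (σ.reg pos) = y at *
  generalize midBound n s t y = u at *
  simp only [scanBody, midBoundExpr, minimum, Expr.lt, ends_seq, ends_assign, add_def, sub_def,
    mul_def, div_def, mod_def, ofNat_def, Expr.eval, Expr.Fits, Expr.cost, WordOp.eval]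
  refine ⟨by omega, by omega, by simp; omega, by omega, h.ends (s t) ?_ fun f hf hf' T hT => ?_⟩
  · simp [*]; omega
  simp [isScratch, htop] at hf hf' ⊢
  refine ⟨by omega, by omega, by omega, by omega, h.ends (s t) ?_ fun f' hg hg' T' hT' => ?_⟩
  · simp [isScratch, *]; omega
  simp [isScratch, htop] at hg hg' ⊢
  have e1 : f res + (f' res - f res) = y := by omega
  simp only [e1, hn, hchg]
  have e2 : y / 2 - (y / 2 - (3 * y - n - 1) / 2) - (y / 2 - (y / 2 - (3 * y - n - 1) / 2) -
      (2 * y - lastChange s t - 1)) = u := by omega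
  simp only [e2]
  have hun : u ≤ n := by omega
  have hyn : y ≤ n := by omega
  clear hb' hm' e1 e2 hf hg
  rw [ends_ite]
  by_cases hle : σ.reg pos ≤ u
  · simp [Expr.eval, Expr.Fits, Expr.cost, WordOp.eval, isScratch, not_lt.2 hle, ends_seq,
      ends_assign, *]
    omega
  · simp [Expr.eval, Expr.Fits, Expr.cost, WordOp.eval, isScratch, not_le.1 hle, ends_seq,
      ends_assign, *]
    repeat' apply And.intro
    any_goals omega
    refine h.ends (s t) ?_ fun f'' hi hi' T'' hT'' => ?_
    · simp [isScratch, *]; omega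
    simp [isScratch, *] at hi hi' ⊢
    omega

theorem scanLoop_ends {w : ℕ} {pr : Cmd} {B : ℕ} {μ : ℕ → ℕ} {m n : ℕ} {s : ℕ → Bool}
    (h : ComputesLastPos w pr B μ m n s) (hw : 10 * n + 20 < 2 ^ w) {t : ℕ} (ht : t ≤ n) {σ : Env}
    (hμ : σ.mem = μ) (hm : σ.reg num = m) (hn : σ.reg len = n) (hb : σ.reg argB = (s t).toNat)
    (htop : σ.reg top = t) (hchg : σ.reg chg = lastChange s t) (hpos : σ.reg pos ≤ n) {k : ℕ}
    (hk : ScanEnds n s t k (σ.reg pos)) :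
    Ends w (loop pos (scanBody pr)) σ (k * (3 * B + 201) + 1) fun τ _ =>
      τ.mem = μ ∧ τ.reg num = m ∧ τ.reg len = n ∧
        (τ.reg out ≠ 0 ↔ σ.reg out ≠ 0 ∨ Scan n s t k (σ.reg pos)) := by
  have h0 : ∀ k, ScanEnds n s t k 0 := fun k => by cases k <;> simp [ScanEnds]
  have h0' : ∀ k, ¬ Scan n s t k 0 := fun k => by cases k <;> simp [Scan]
  refine (ends_loop (fun k' τ => τ.mem = μ ∧ τ.reg num = m ∧ τ.reg len = n ∧
    τ.reg argB = (s t).toNat ∧ τ.reg top = t ∧ τ.reg chg = lastChange s t ∧ τ.reg pos ≤ n ∧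
    ScanEnds n s t k' (τ.reg pos) ∧ ((τ.reg out ≠ 0 ∨ Scan n s t k' (τ.reg pos)) ↔
      (σ.reg out ≠ 0 ∨ Scan n s t k (σ.reg pos)))) (3 * B + 200) (k := k)
    ⟨hμ, hm, hn, hb, htop, hchg, hpos, hk, Iff.rfl⟩ ?_).mono le_rfl ?_
  · rintro k' τ ⟨h1, h2, h3, h4, h5, h6, h7, h8, h9⟩ hne
    cases k' with
    | zero => exact absurd h8 hne
    | succ k' =>
      refine ⟨k', rfl, (scanBody_ends h hw ht h1 h2 h3 h4 h5 h6 h7).mono le_rfl ?_⟩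
      rintro ρ _ _ ⟨g1, g2, g3, g4, g5, g6, g7, g8⟩ -
      refine ⟨g1, g2, g3, g4, g5, g6, g7, ?_⟩
      rw [← h9]
      split_ifs at g8 with hh
      · simp [g8, h0, Scan, hh, hne]
      · rw [g8.1, g8.2]
        exact ⟨(h8.resolve_left hne).resolve_left hh, by simp [Scan, hh, hne]⟩
  · rintro ρ _ _ ⟨⟨k', h1, h2, h3, h4, h5, h6, h7, h8, h9⟩, hp⟩ -
    refine ⟨h1, h2, h3, ?_⟩
    rw [← h9, hp]
    simp [h0']

theorem crossingTest_ends {w : ℕ} {pr : Cmd} {B : ℕ} {μ : ℕ → ℕ} {m n : ℕ} {s : ℕ → Bool}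
    (h : ComputesLastPos w pr B μ m n s) (hw : 10 * n + 20 < 2 ^ w) {t : ℕ} (ht : t ≤ n)
    (ht0 : t ≠ 0) {σ : Env}
    (hμ : σ.mem = μ) (hm : σ.reg num = m) (hn : σ.reg len = n) (htop : σ.reg top = t) :
    Ends w (crossingTest pr) σ (4 * B + 200) fun τ _ =>
      τ.mem = μ ∧ τ.reg num = m ∧ τ.reg len = n ∧ τ.reg argB = (s t).toNat ∧ τ.reg top = t ∧
      τ.reg chg = lastChange s t ∧ τ.reg argQ = t % 2 ∧ τ.reg out = σ.reg out ∧
      τ.reg res ≤ n ∧ (τ.reg res ≠ 0 ↔ Crossing n s t) := by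
  have hw0 : w ≠ 0 := by
    rintro rfl
    omega
  have hc : lastChange s t ≤ t := lastPos_le ..
  simp only [crossingTest, firstBoundExpr, minimum, equal, ends_seq, ends_assign, sub_def, mul_def,
    div_def, mod_def, ofNat_def, Expr.eval, Expr.Fits, Expr.cost, WordOp.eval]
  simp [htop]
  repeat' apply And.intro
  any_goals omega
  refine h.ends true ?_ fun f hf hf' T hT => ?_
  · simp [*]; omega
  simp [isScratch, htop] at hf hf' ⊢
  -- the position `t` itself is found precisely if its character is `true`
  have e1 : (if f res = t then 1 else 0) = (s t).toNat := by
    by_cases hs : s t = true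
    · have : t ≤ f res := hf ▸ le_lastPos le_rfl rfl hs
      simp [hs, le_antisymm hf' this]
    · have : f res ≠ t := by
        intro he
        have := (lastPos_spec (s := s) (b := true) (q := t % 2) (u := t) (by omega)).2
        rw [← hf, he] at this
        exact hs this
      simp [hs, this]
  have e2 : (s t).toNat ≤ 1 := Bool.toNat_le _
  have e3 : 1 - (s t).toNat = (!s t).toNat := by cases s t <;> rfl
  have e4 : (!s t).toNat ≤ 1 := Bool.toNat_le _
  rw [e1, e3]
  clear hf
  repeat' apply And.intro
  any_goals omega
  refine h.ends (!s t) ?_ fun g hg hg' T' hT' => ?_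
  · simp [isScratch, *]; omega
  simp [isScratch] at hg hg' ⊢
  rw [show lastPos s (!s t) (t % 2) t = lastChange s t from rfl] at hg
  rw [hg, hn]
  have e5 : lastChange s t / 3 - (lastChange s t / 3 - (3 * lastChange s t - 2 * n - 2)) =
      firstBound n (lastChange s t) := by
    unfold firstBound
    omega
  have e6 : firstBound n (lastChange s t) ≤ n := by
    unfold firstBound
    omega
  rw [e5]
  repeat' apply And.intro
  any_goals omega
  refine h.ends (!s t) ?_ fun i hi hi' U hU => ?_
  · simp [isScratch, *]; omega
  simp [isScratch] at hi hi' ⊢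
  change i res = crossingPos n s t at hi
  rw [hi] at hi' ⊢
  repeat' apply And.intro
  any_goals omega
  refine h.ends (s t) ?_ fun j hj hj' U' hU' => ?_
  · simp [isScratch, *]; omega
  simp [isScratch, htop] at hj hj' ⊢
  refine ⟨hμ, hm, by omega, by omega, ?_⟩
  simp [hj, Crossing]

theorem detect_ends {w : ℕ} {pr : Cmd} {B : ℕ} {μ : ℕ → ℕ} {m n : ℕ} {s : ℕ → Bool}
    (h : ComputesLastPos w pr B μ m n s) (hw : 10 * n + 20 < 2 ^ w) {t k : ℕ} (ht : t ≤ n)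
    (hnt : n ≤ t + 1) (hk : t < 2 ^ k) {σ : Env}
    (hμ : σ.mem = μ) (hm : σ.reg num = m) (hn : σ.reg len = n) (htop : σ.reg top = t) :
    Ends w (detect pr) σ (5 * B + 300 + (k + 3) * (3 * B + 201)) fun τ _ =>
      τ.mem = μ ∧ τ.reg num = m ∧ τ.reg len = n ∧
        (τ.reg out ≠ 0 ↔ σ.reg out ≠ 0 ∨ Detects n s (k + 3) t) := by
  have hw0 : w ≠ 0 := by
    rintro rfl
    omega
  rw [detect, ends_ite]
  by_cases ht0 : t = 0
  · simp [Expr.eval, Expr.Fits, Expr.cost, ends_skip, Detects, *]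
    omega
  simp only [Expr.eval, Expr.Fits, Expr.cost, htop]
  refine ⟨by omega, by omega, fun _ => ?_, fun h => absurd h ht0⟩
  rw [ends_seq]
  refine (crossingTest_ends h hw ht ht0 hμ hm hn htop).mono (by omega) ?_
  rintro τ _ T ⟨h1, h2, h3, h4, h5, h6, h7, h8, hres, h9⟩ hT
  rw [ends_ite]
  simp only [Expr.eval, Expr.Fits, Expr.cost]
  refine ⟨by omega, by omega, fun hc => ?_, fun hc => ?_⟩
  · have hcr := h9.1 hc
    simp [ends_assign, ofNat_def, Expr.eval, Expr.Fits, Expr.cost, Detects, *]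
    omega
  · have hcr : ¬ Crossing n s t := fun h => h9.2 h hc
    have e1 : t / 3 - (t / 3 - (3 * t - 2 * n - 2)) = firstBound n t := by
      unfold firstBound
      omega
    have e2 : firstBound n t ≤ n := by
      unfold firstBound
      omega
    simp only [firstBoundExpr, minimum, ends_seq, ends_assign, sub_def, mul_def, div_def,
      ofNat_def, Expr.eval, Expr.Fits, Expr.cost, WordOp.eval, h5, h3, e1]
    refine ⟨by omega, by omega, h.ends (s t) ?_ fun f hf hf' T' hT' => ?_⟩
    · simp [*]; omega
    simp [isScratch, h7] at hf hf' ⊢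
    change f res = startPos n s t at hf
    refine ⟨by omega, by omega, ?_⟩
    refine (scanLoop_ends h hw ht (k := k + 3) ?_ ?_ ?_ ?_ ?_ ?_ ?_ ?_).mono ?_ ?_
    on_goal 10 =>
      rintro ρ _ _ ⟨g1, g2, g3, g4⟩ -
      refine ⟨g1, g2, g3, g4.trans ?_⟩
      simp [isScratch, h8, hf, Detects, hcr, show 0 < t by omega]
    on_goal 9 => omega
    on_goal 8 => simpa [hf] using scanEnds_startPos hnt hk hcr
    all_goals simp [isScratch, *]
    omega

/-- The search along the right end of the string, for both parities. -/
def detectBoth (pr : Cmd) : Cmd :=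
  top ::= ♮len ;; detect pr ;; top ::= ♮len - 1 ;; detect pr

theorem detectBoth_ends {w : ℕ} {pr : Cmd} {B : ℕ} {μ : ℕ → ℕ} {m n : ℕ} {s : ℕ → Bool}
    (h : ComputesLastPos w pr B μ m n s) (hw : 10 * n + 20 < 2 ^ w) {k : ℕ} (hk : n < 2 ^ k)
    {σ : Env} (hμ : σ.mem = μ) (hm : σ.reg num = m) (hn : σ.reg len = n) :
    Ends w (detectBoth pr) σ ((k + 4) * (20 * B + 1000)) fun τ _ =>
      τ.mem = μ ∧ τ.reg num = m ∧ τ.reg len = n ∧ (τ.reg out ≠ 0 ↔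
        σ.reg out ≠ 0 ∨ Detects n s (k + 3) n ∨ Detects n s (k + 3) (n - 1)) := by
  have hw0 : w ≠ 0 := by
    rintro rfl
    omega
  have hT : 2 * ((5 * B + 300 + (k + 3) * (3 * B + 201)) + 20) ≤ (k + 4) * (20 * B + 1000) := by
    nlinarith [Nat.zero_le (k * B)]
  simp only [detectBoth, ends_seq, ends_assign, Expr.eval, Expr.Fits, Expr.cost, sub_def,
    ofNat_def, WordOp.eval]
  refine ⟨by omega, by omega, ?_⟩
  refine (detect_ends (k := k) (t := n) h hw le_rfl (by omega) hk ?_ ?_ ?_ ?_).mono (by omega) ?_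
  on_goal 5 =>
    rintro τ _ T ⟨h1, h2, h3, h4⟩ hT'
    refine ⟨by omega, by omega, ?_⟩
    refine (detect_ends (k := k) (t := n - 1) h hw (by omega) (by omega) (by omega)
      ?_ ?_ ?_ ?_).mono (by omega) ?_
    on_goal 5 =>
      rintro ρ _ _ ⟨g1, g2, g3, g4⟩ -
      refine ⟨g1, g2, g3, g4.trans ?_⟩
      simp only [Env.set_reg, reduceCtorEq, if_false] at h4 ⊢
      rw [h4, or_assoc]
  all_goals simp [*]

end Cmd

/-! ### Strings as colourings, and the machine -/

theorem lastPos_congr {s s' : ℕ → Bool} {b : Bool} {q u : ℕ}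
    (h : ∀ i, 0 < i → i ≤ u → s i = s' i) : lastPos s b q u = lastPos s' b q u := by
  apply eq_lastPos
  · intro h0
    have h1 : lastPos s b q u ≤ u := lastPos_le ..
    have h2 := lastPos_spec h0
    exact ⟨h1, h2.1, by rw [← h _ (by omega) h1, h2.2]⟩
  · intro y h0 h1 h2 h3
    exact le_lastPos h1 h2 (by rw [h y h0 h1, h3])

/-- The character at the position `i` of a string, positions being counted from `1`. -/
def charFn (S : List Bool) (i : ℕ) : Bool :=
  S.getD (i - 1) false

theorem charAt_eq_some_iff {S : List Bool} {i : ℤ} {a : Bool} :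
    charAt S i = some a ↔ 1 ≤ i ∧ i ≤ S.length ∧ charFn S i.toNat = a := by
  unfold charAt charFn
  by_cases h : 1 ≤ i
  · rw [if_pos h, show i.toNat - 1 = (i - 1).toNat by omega]
    by_cases h' : (i - 1).toNat < S.length
    · simp only [List.getD_eq_getElem?_getD, List.getElem?_eq_getElem h', h, Option.some_inj,
        show i ≤ S.length by omega, Option.getD_some, true_and]
    · simp only [List.getElem?_eq_none (not_lt.1 h'), show ¬ i ≤ S.length by omega]
      simp
  · simp [h]

theorem hasCadence_three_iff (S : List Bool) :
    HasCadence S 3 ↔ HasThreeCadence S.length (charFn S) := by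
  constructor
  · rintro ⟨i, d, ⟨hd, a, ha⟩, h1, h2⟩
    obtain ⟨a1, a2, a3⟩ := charAt_eq_some_iff.1 (ha 0 (by omega))
    obtain ⟨b1, b2, b3⟩ := charAt_eq_some_iff.1 (ha 1 (by omega))
    obtain ⟨c1, c2, c3⟩ := charAt_eq_some_iff.1 (ha 2 (by omega))
    push_cast at *
    exact ⟨_, _, _, by omega, by omega, by omega, by omega, by omega, a3.trans c3.symm,
      b3.trans c3.symm⟩
  · rintro ⟨x, y, z, h1, h2, h3, h4, h5, h6, h7⟩
    refine ⟨x, y - x, ⟨by omega, charFn S z, fun j hj => ?_⟩, by omega, by push_cast; omega⟩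
    rw [charAt_eq_some_iff]
    interval_cases j
    · exact ⟨by omega, by omega, by simpa using h6⟩
    · exact ⟨by omega, by omega, by simpa using h7⟩
    · refine ⟨by omega, by omega, ?_⟩
      rw [show ((x : ℤ) + (2 : ℕ) * (y - x)).toNat = z by omega]

/-- The environment in which a program is started on an input. -/
def Env.init (input : List ℕ) : Env where
  reg v := if v = .out then input.length else 0
  mem a := input.getD a 0

theorem Cmd.decides_of_ends {w T : ℕ} {c : Cmd} {input : List ℕ} {answer : Prop}
    (hl : input.length < 2 ^ w) (hv : ∀ v ∈ input, v < 2 ^ w)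
    (h : Ends w c (Env.init input) T fun τ _ => τ.reg .out ≠ 0 ↔ answer) :
    c.compile.Decides w T input answer := by
  rw [Ends] at h
  obtain ⟨s', t, h1, h2, h3⟩ := h
  obtain ⟨τ, h4, h5⟩ := h1.compile (σ := RamState.init input) ⟨fun v => by
    have : v.idx = 0 ↔ v = .out := by cases v <;> simp [Var.idx]
    simp [RamState.init, Env.init, this], rfl⟩
  refine ⟨⟨hl, hv⟩, τ, t, h4, h2, ?_⟩
  rw [show τ.reg 0 = s'.reg .out from h5.1 .out]
  exact h3

/-! ### Uncompressed strings -/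

theorem lastPos_self {s : ℕ → Bool} {b : Bool} {y : ℕ} (hy : 0 < y) :
    lastPos s b (y % 2) y = if s y = b then y else
      if 2 ≤ y then lastPos s b ((y - 2) % 2) (y - 2) else 0 := by
  symm
  apply eq_lastPos
  · intro h0
    split_ifs at h0 ⊢ with h1 h2
    · exact ⟨le_rfl, rfl, h1⟩
    · have := lastPos_le s b ((y - 2) % 2) (y - 2)
      have h3 := lastPos_spec h0
      exact ⟨by omega, by omega, h3.2⟩
    · exact absurd rfl h0
  · intro z h0 h1 h2 h3
    split_ifs with h4 h5
    · exact h1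
    · have : z ≠ y := by rintro rfl; exact h4 h3
      exact le_lastPos (by omega) (by omega) h3
    · exact absurd (by rw [show y = z by omega]; exact h3) h4

theorem lastPos_adjust {s : ℕ → Bool} {b : Bool} {q u : ℕ} (hq : q < 2) :
    lastPos s b ((u - (u + q) % 2) % 2) (u - (u + q) % 2) = lastPos s b q u := by
  apply eq_lastPos
  · intro h0
    have h1 := lastPos_le s b ((u - (u + q) % 2) % 2) (u - (u + q) % 2)
    have h2 := lastPos_spec h0
    exact ⟨by omega, by omega, h2.2⟩
  · intro y h0 h1 h2 h3
    exact le_lastPos (by omega) (by omega) h3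

namespace Cmd

open Expr Var

/-- The body of the loop that tabulates `lastPos`: the entries for the next position are those
for the position two before, except for the character at the new position. -/
def tableBody (src : Expr) : Cmd :=
  cnt ::= ♮len + 1 - ♮rem ;; val ::= load src ;;
  store (♮len + 2 * ♮cnt + 2) (load (♮len + 2 * ♮cnt - 2)) ;;
  store (♮len + 2 * ♮cnt + 3) (load (♮len + 2 * ♮cnt - 1)) ;;
  store (♮len + 2 * ♮cnt + 2 + ♮val) ♮cnt ;;
  rem ::= ♮rem - 1

/-- Tabulate `lastPos` for the string whose character at the position `cnt` is found in the memory
cell `src`. -/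
def buildTable (src : Expr) : Cmd :=
  rem ::= ♮len ;; loop rem (tableBody src)

/-- Look up a value of `lastPos`. -/
def lookup : Cmd :=
  res ::= load (♮len + 2 * (♮argU - (♮argU + ♮argQ) % 2) + 2 + ♮argB)

/-- The memory contains the input `x` of length `n` and the values of `lastPos` for positions up
to `l`; the two cells after the input stand for a position `-1`. -/
structure IsTable (n : ℕ) (x : ℕ → ℕ) (s : ℕ → Bool) (l : ℕ) (μ : ℕ → ℕ) : Prop where
  input : ∀ a < n, μ a = x a
  left₀ : μ n = 0
  left₁ : μ (n + 1) = 0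
  entry : ∀ y ≤ l, ∀ b : Bool, μ (n + 2 * y + 2 + b.toNat) = lastPos s b (y % 2) y

theorem IsTable.zero {n : ℕ} {x : ℕ → ℕ} {s s' : ℕ → Bool} {l : ℕ} {μ : ℕ → ℕ}
    (h : IsTable n x s l μ) : IsTable n x s' 0 μ := by
  refine ⟨h.input, h.left₀, h.left₁, fun y hy b => ?_⟩
  obtain rfl : y = 0 := by omega
  rw [h.entry 0 (by omega) b]
  simp [lastPos]

theorem IsTable.succ {n : ℕ} {x : ℕ → ℕ} {s : ℕ → Bool} {l : ℕ} {μ μ' : ℕ → ℕ}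
    (h : IsTable n x s l μ) (h1 : ∀ a, a < n + 2 * l + 4 → μ' a = μ a)
    (h2 : ∀ b : Bool, μ' (n + 2 * (l + 1) + 2 + b.toNat) =
      if s (l + 1) = b then l + 1 else μ (n + 2 * l + b.toNat)) : IsTable n x s (l + 1) μ' := by
  refine ⟨fun a ha => ?_, ?_, ?_, fun y hy b => ?_⟩
  · rw [h1 a (by omega), h.input a ha]
  · rw [h1 _ (by omega), h.left₀]
  · rw [h1 _ (by omega), h.left₁]
  · have hb := Bool.toNat_le b
    rcases Nat.lt_or_ge y (l + 1) with hy' | hy'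
    · rw [h1 _ (by omega), h.entry y (by omega) b]
    · obtain rfl : y = l + 1 := by omega
      rw [h2, lastPos_self (by omega)]
      split_ifs with h3 h4
      · rfl
      · rw [show n + 2 * l + b.toNat = n + 2 * (l + 1 - 2) + 2 + b.toNat by omega,
          h.entry _ (by omega)]
      · obtain rfl : l = 0 := by omega
        cases b
        · exact h.left₀
        · exact h.left₁

theorem lookup_computes {w n m : ℕ} {x μ : ℕ → ℕ} {s : ℕ → Bool} (h : IsTable n x s n μ)
    (hw : 10 * n + 20 < 2 ^ w) : ComputesLastPos w lookup 40 μ m n s := by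
  intro σ b hμ hm hn hb hq hu
  have hb' := Bool.toNat_le b
  have hval := h.entry (σ.reg argU - (σ.reg argU + σ.reg argQ) % 2) (by omega) b
  rw [lastPos_adjust hq] at hval
  have hle : lastPos s b (σ.reg argQ) (σ.reg argU) ≤ σ.reg argU := lastPos_le ..
  simp only [lookup, ends_assign, add_def, sub_def, mul_def, mod_def, ofNat_def, Expr.eval,
    Expr.Fits, Expr.cost, WordOp.eval, hμ, hn, hb, hval]
  refine ⟨by omega, by omega, fun v => if v = res then lastPos s b (σ.reg argQ) (σ.reg argU)
    else σ.reg v, ?_, by simp⟩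
  unfold Env.set Env.havoc
  congr 1
  funext v
  by_cases hv : v = res
  · simp [hv, isScratch]
  · simp [hv]

theorem tableBody_ends {w n l : ℕ} {x : ℕ → ℕ} {s : ℕ → Bool} {src : Expr} {σ : Env}
    (hw : 10 * n + 20 < 2 ^ w) (hl : l < n) (hs : src.cost ≤ 20)
    (hsrc : ∀ τ : Env, τ.reg len = n → τ.reg cnt = l + 1 → src.Fits w τ ∧
      src.eval τ < n ∧ x (src.eval τ) = (s (l + 1)).toNat)
    (h : IsTable n x s l σ.mem) (hn : σ.reg len = n) (hr : σ.reg rem = n - l) :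
    Ends w (tableBody src) σ 200 fun τ _ =>
      IsTable n x s (l + 1) τ.mem ∧ τ.reg len = n ∧ τ.reg rem = n - (l + 1) ∧
        τ.reg out = σ.reg out ∧ τ.reg num = σ.reg num := by
  have hw0 : w ≠ 0 := by
    rintro rfl
    omega
  have hb' := Bool.toNat_le (s (l + 1))
  have e1 : n + 1 - (n - l) = l + 1 := by omega
  have hval : ∀ b : Bool, σ.mem (n + 2 * l + b.toNat) ≤ n := by
    intro b
    rcases Nat.eq_zero_or_pos l with rfl | hl0
    · cases b
      · simp [h.left₀]
      · simp [h.left₁]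
    · rw [show n + 2 * l + b.toNat = n + 2 * (l - 1) + 2 + b.toNat by omega,
        h.entry _ (by omega)]
      exact (lastPos_le ..).trans (by omega)
  have v0 := hval false
  have v1 := hval true
  simp only [Bool.toNat_false, Bool.toNat_true, add_zero] at v0 v1
  obtain ⟨s1, s2, s3⟩ := hsrc (σ.set cnt (l + 1)) (by simpa using hn) (by simp)
  simp only [tableBody, ends_seq, ends_assign, ends_store, add_def, sub_def, mul_def,
    ofNat_def, Expr.eval, Expr.Fits, Expr.cost, WordOp.eval]
  simp [hn, hr, e1, s1, h.input _ s2, s3, Function.update_apply]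
  simp only [show n + 2 * (l + 1) - 2 = n + 2 * l by omega,
    show n + 2 * (l + 1) - 1 = n + 2 * l + 1 by omega]
  simp only [show ¬ n + 2 * (l + 1) = n + 2 * (l + 1) + 1 + 2 by omega, if_false]
  repeat' apply And.intro
  any_goals omega
  refine h.succ (fun a ha => ?_) fun b => ?_
  · rw [Function.update_of_ne (by omega), Function.update_of_ne (by omega),
      Function.update_of_ne (by omega)]
  · cases b <;> cases s (l + 1) <;> simp

theorem buildTable_ends {w n : ℕ} {x : ℕ → ℕ} {s : ℕ → Bool} {src : Expr} {σ : Env}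
    (hw : 10 * n + 20 < 2 ^ w) (hs : src.cost ≤ 20)
    (hsrc : ∀ (τ : Env) (l : ℕ), l < n → τ.reg len = n → τ.reg cnt = l + 1 → src.Fits w τ ∧
      src.eval τ < n ∧ x (src.eval τ) = (s (l + 1)).toNat)
    (h : IsTable n x s 0 σ.mem) (hn : σ.reg len = n) :
    Ends w (buildTable src) σ (201 * n + 10) fun τ _ =>
      IsTable n x s n τ.mem ∧ τ.reg len = n ∧ τ.reg out = σ.reg out ∧ τ.reg num = σ.reg num := by
  simp only [buildTable, ends_seq, ends_assign, Expr.eval, Expr.Fits, Expr.cost, hn]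
  refine ⟨by omega, by omega, ?_⟩
  refine (ends_loop (k := n) (fun k τ => k ≤ n ∧ τ.reg rem = k ∧ IsTable n x s (n - k) τ.mem ∧
    τ.reg len = n ∧ τ.reg out = σ.reg out ∧ τ.reg num = σ.reg num) 200 ?_ ?_).mono (by omega) ?_
  · simpa [hn] using h
  · rintro k τ ⟨h1, h2, h3, h4, h5, h6⟩ hne
    refine ⟨k - 1, by omega, (tableBody_ends hw (l := n - k) (by omega) hs
      (fun τ => hsrc τ _ (by omega)) h3 h4 (by omega)).mono le_rfl ?_⟩
    rintro ρ _ _ ⟨g1, g2, g3, g4, g5⟩ -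
    exact ⟨by omega, by omega, by rwa [show n - (k - 1) = n - k + 1 by omega], g2,
      g4.trans h5, g5.trans h6⟩
  · rintro ρ _ _ ⟨⟨k, h1, h2, h3, h4, h5, h6⟩, h7⟩ -
    obtain rfl : k = 0 := by omega
    exact ⟨h3, h4, h5, h6⟩

/-- The decision procedure for uncompressed strings. -/
def decideString : Cmd :=
  len ::= ♮out ;; out ::= 0 ;;
  buildTable (♮cnt - 1) ;; detectBoth lookup ;;
  buildTable (♮len - ♮cnt) ;; detectBoth lookup

theorem decideString_ends {w n k : ℕ} {x : ℕ → ℕ} {s : ℕ → Bool} {σ : Env}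
    (hw : 10 * n + 20 < 2 ^ w) (hk : n < 2 ^ k) (hx : ∀ i < n, x i = (s (i + 1)).toNat)
    (h : IsTable n x s 0 σ.mem) (hn : σ.reg out = n) :
    Ends w decideString σ (402 * n + 100 + (k + 4) * 3600) fun τ _ =>
      τ.reg out ≠ 0 ↔ HasThreeCadence n s := by
  simp only [decideString, ends_seq, ends_assign, Expr.eval, Expr.Fits, Expr.cost, ofNat_def, hn]
  refine ⟨by omega, by omega, by omega, by omega, ?_⟩
  refine (buildTable_ends (n := n) hw ?_ ?_ (x := x) (s := s) (by simpa using h) (by simp)).mono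
    (by omega) ?_
  · simp [Expr.cost, sub_def]
  · intro τ l hl h1 h2
    simp only [sub_def, Expr.Fits, Expr.eval, WordOp.eval, h2]
    exact ⟨by omega, by omega, hx _ (by omega)⟩
  rintro σ₁ _ T₁ ⟨a1, a2, a3, -⟩ hT₁
  refine (detectBoth_ends (lookup_computes a1 hw) hw hk rfl rfl a2).mono (by omega) ?_
  rintro σ₂ _ T₂ ⟨b1, -, b2, b3⟩ hT₂
  -- the table is overwritten by that of the reversed string
  refine (buildTable_ends (n := n) hw ?_ ?_ (x := x) (s := revPos n s) (b1 ▸ a1.zero) b2).mono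
    (by omega) ?_
  · simp [Expr.cost, sub_def]
  · intro τ l hl h1 h2
    simp only [sub_def, Expr.Fits, Expr.eval, WordOp.eval, h1, h2, revPos]
    refine ⟨by omega, by omega, ?_⟩
    rw [hx _ (by omega), show n - (l + 1) + 1 = n + 1 - (l + 1) by omega]
  rintro σ₃ _ T₃ ⟨c1, c2, c3, -⟩ hT₃
  refine (detectBoth_ends (lookup_computes c1 hw) hw hk rfl rfl c2).mono (by omega) ?_
  rintro σ₄ _ T₄ ⟨-, -, -, d⟩ -
  rw [d, c3, b3, a3, hasThreeCadence_iff hk]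
  simp

end Cmd

theorem linearTimeSolvable_hasCadence :
    LinearTimeSolvable encodeString List.length (fun S : List Bool => HasCadence S 3) := by
  refine ⟨Cmd.decideString.compile, 20000, fun S => ?_⟩
  set n := S.length with hn
  have hk : n < 2 ^ (Nat.log 2 n + 1) := Nat.lt_pow_succ_log_self (by omega) n
  have hkn : Nat.log 2 n ≤ n := Nat.log_le_self 2 n
  -- all values that occur are at most `10 n + 20`
  have hw : 10 * n + 20 < 2 ^ (20000 * (Nat.log 2 n + 1)) :=
    calc 10 * n + 20 < 2 ^ 5 * 2 ^ (Nat.log 2 n + 1) := by omega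
      _ = 2 ^ (5 + (Nat.log 2 n + 1)) := (pow_add ..).symm
      _ ≤ _ := Nat.pow_le_pow_right (by omega) (by omega)
  have hx : ∀ a, (encodeString S).getD a 0 = (charFn S (a + 1)).toNat := by
    intro a
    simp only [encodeString, charFn, List.getD_eq_getElem?_getD, List.getElem?_map,
      Nat.add_sub_cancel]
    cases S[a]? <;> rfl
  have hout : ∀ a, n ≤ a → charFn S (a + 1) = false := by
    intro a ha
    simp [charFn, List.getElem?_eq_none (hn ▸ ha)]
  have hmem : ∀ a, n ≤ a → (Env.init (encodeString S)).mem a = 0 := by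
    intro a ha
    change (encodeString S).getD a 0 = 0
    rw [hx, hout a ha]
    rfl
  simp only [hasCadence_three_iff]
  apply Cmd.decides_of_ends
  · simp only [encodeString, List.length_map]
    omega
  · intro v hv
    obtain ⟨b, -, rfl⟩ := List.mem_map.1 hv
    have := Bool.toNat_le b
    omega
  · refine (Cmd.decideString_ends hw hk (x := fun a => (charFn S (a + 1)).toNat)
      (fun _ _ => rfl) ⟨fun a _ => hx a, ?_, ?_, ?_⟩ ?_).mono (by omega) fun _ _ _ h _ => h
    · exact hmem _ (by omega)
    · exact hmem _ (by omega)
    · intro y hy b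
      obtain rfl : y = 0 := by omega
      rw [hmem _ (by omega)]
      simp [lastPos]
    · simp [Env.init, encodeString, hn]

/-! ### Strings given by grammars -/

theorem charFn_append_left {A B : List Bool} {i : ℕ} (h0 : 0 < i) (h : i ≤ A.length) :
    charFn (A ++ B) i = charFn A i := by
  unfold charFn
  rw [List.getD_append _ _ _ _ (by omega)]

theorem charFn_append_right {A B : List Bool} {i : ℕ} (h : 0 < i) :
    charFn (A ++ B) (A.length + i) = charFn B i := by
  unfold charFn
  rw [List.getD_append_right _ _ _ _ (by omega)]
  congr 1
  omega

theorem lastPos_append_left {A B : List Bool} {b : Bool} {q u : ℕ} (hu : u ≤ A.length) :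
    lastPos (charFn (A ++ B)) b q u = lastPos (charFn A) b q u :=
  lastPos_congr fun _ h0 h => charFn_append_left h0 (h.trans hu)

theorem lastPos_append_right {A B : List Bool} {b : Bool} {q u : ℕ} (hq : q < 2) :
    lastPos (charFn (A ++ B)) b q (A.length + u) =
      if lastPos (charFn B) b ((q + A.length) % 2) u ≠ 0 then
        A.length + lastPos (charFn B) b ((q + A.length) % 2) u
      else lastPos (charFn A) b q A.length := by
  symm
  apply eq_lastPos
  · intro h0
    by_cases h : lastPos (charFn B) b ((q + A.length) % 2) u = 0
    · rw [if_neg (not_not.2 h)] at h0 ⊢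
      have h1 := lastPos_le (charFn A) b q A.length
      have h2 := lastPos_spec h0
      refine ⟨by omega, h2.1, ?_⟩
      rw [charFn_append_left (by omega) h1, h2.2]
    · rw [if_pos h]
      have h1 := lastPos_le (charFn B) b ((q + A.length) % 2) u
      have h2 := lastPos_spec h
      refine ⟨by omega, by omega, ?_⟩
      rw [charFn_append_right (by omega), h2.2]
  · intro y h0 h1 h2 h3
    by_cases hy : y ≤ A.length
    · rw [charFn_append_left h0 hy] at h3
      have := le_lastPos hy h2 h3
      split_ifs with h
      · omega
      · omega
    · obtain ⟨z, rfl⟩ : ∃ z, y = A.length + z := ⟨y - A.length, by omega⟩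
      rw [charFn_append_right (by omega)] at h3
      have h4 : z ≤ lastPos (charFn B) b ((q + A.length) % 2) u :=
        le_lastPos (by omega) (by omega) h3
      rw [if_pos (by omega)]
      omega

theorem lastPos_singleton {c b : Bool} {q u : ℕ} (hu : u ≤ 1) :
    lastPos (charFn [c]) b q u = if u = 1 ∧ c = b ∧ q = 1 then 1 else 0 := by
  symm
  apply eq_lastPos
  · intro h0
    split_ifs at h0 ⊢ with h
    · exact ⟨by omega, by omega, by simpa [charFn] using h.2.1⟩
    · exact absurd rfl h0
  · intro y h0 h1 h2 h3
    obtain rfl : y = 1 := by omega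
    rw [if_pos ⟨by omega, by simpa [charFn] using h3, by omega⟩]

/-- The input `x` lists the `m` rules of a grammar whose nonterminal `i` derives `E i`; the two
nonterminals of a pair, in the order in which they are to be read, are at the offsets
`p` and `q`. -/
def Derives (m : ℕ) (x : ℕ → ℕ) (p q : ℕ) (E : ℕ → List Bool) : Prop :=
  ∀ i < m, (∃ c : Bool, x (3 * i) = 0 ∧ x (3 * i + 1) = c.toNat ∧ E i = [c]) ∨
    (x (3 * i) = 1 ∧ x (3 * i + p) < i ∧ x (3 * i + q) < i ∧
      E i = E (x (3 * i + p)) ++ E (x (3 * i + q)))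

theorem Derives.length_le {m : ℕ} {x : ℕ → ℕ} {p q : ℕ} {E : ℕ → List Bool}
    (h : Derives m x p q E) {i : ℕ} (hi : i < m) : (E i).length ≤ 2 ^ i := by
  induction i using Nat.strong_induction_on with
  | _ i ih =>
    rcases h i hi with ⟨c, -, -, hE⟩ | ⟨-, hj, hk, hE⟩
    · rw [hE]
      exact Nat.one_le_two_pow
    · obtain ⟨i, rfl⟩ : ∃ i', i = i' + 1 := ⟨i - 1, by omega⟩
      have h1 := (ih _ hj (by omega)).trans (Nat.pow_le_pow_right two_pos (Nat.le_of_lt_succ hj))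
      have h2 := (ih _ hk (by omega)).trans (Nat.pow_le_pow_right two_pos (Nat.le_of_lt_succ hk))
      rw [hE, List.length_append, pow_succ]
      omega

/-- The five memory cells from `a` on describe the string `S`: its length, and the last
position of each character and parity. -/
structure IsNode (μ : ℕ → ℕ) (a : ℕ) (S : List Bool) : Prop where
  length : μ a = S.length
  last : ∀ (b : Bool) (q : ℕ), q < 2 →
    μ (a + (1 + 2 * b.toNat + q)) = lastPos (charFn S) b q S.length

theorem IsNode.congr {μ μ' : ℕ → ℕ} {a : ℕ} {S : List Bool} (h : IsNode μ a S)
    (hμ : ∀ i, i < a + 5 → μ' i = μ i) : IsNode μ' a S := by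
  refine ⟨by rw [hμ _ (by omega), h.length], fun b q hq => ?_⟩
  have := Bool.toNat_le b
  rw [hμ _ (by omega), h.last b q hq]

/-- The memory contains the input and the descriptions of the strings derived from the first
`l` nonterminals. -/
structure IsNodeTable (m : ℕ) (x : ℕ → ℕ) (E : ℕ → List Bool) (l : ℕ) (μ : ℕ → ℕ) : Prop where
  input : ∀ a < 3 * m, μ a = x a
  node : ∀ i < l, IsNode μ (3 * m + 5 * i) (E i)

theorem IsNodeTable.succ {m : ℕ} {x : ℕ → ℕ} {E : ℕ → List Bool} {l : ℕ} {μ μ' : ℕ → ℕ}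
    (h : IsNodeTable m x E l μ) (h1 : ∀ a, a < 3 * m + 5 * l → μ' a = μ a)
    (h2 : IsNode μ' (3 * m + 5 * l) (E l)) : IsNodeTable m x E (l + 1) μ' := by
  refine ⟨fun a ha => by rw [h1 a (by omega), h.input a ha], fun i hi => ?_⟩
  rcases Nat.lt_or_ge i l with hi' | hi'
  · exact (h.node i hi').congr fun a ha => h1 a (by omega)
  · obtain rfl : i = l := by omega
    exact h2

namespace Cmd

open Expr Var

/-- The entry for the character `b` and the parity `q` of a pair. The variables `lft`, `rgt` and
`wid` hold the addresses of the descriptions of the two parts and of the whole, and `off`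
the length of the left part. -/
def nodeCell (b : Bool) (q : ℕ) : Cmd :=
  val ::= load (♮rgt + (lit (1 + 2 * b.toNat) + (lit q + ♮off) % 2)) ;;
  ite ♮val (store (♮wid + lit (1 + 2 * b.toNat + q)) (♮off + ♮val))
    (store (♮wid + lit (1 + 2 * b.toNat + q)) (load (♮lft + lit (1 + 2 * b.toNat + q))))

/-- All four entries for a pair. -/
def nodeCells : Cmd :=
  nodeCell false 0 ;; nodeCell false 1 ;; nodeCell true 0 ;; nodeCell true 1

/-- The body of the loop that describes the strings derived from the nonterminals. -/
def nodeBody (p q : ℕ) : Cmd :=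
  nod ::= ♮num - ♮rem ;; wid ::= 3 * ♮num + 5 * ♮nod ;;
  ite (load (3 * ♮nod))
    (lft ::= 3 * ♮num + 5 * load (3 * ♮nod + lit p) ;;
      rgt ::= 3 * ♮num + 5 * load (3 * ♮nod + lit q) ;;
      off ::= load ♮lft ;; store ♮wid (♮off + load ♮rgt) ;;
      nodeCells)
    (val ::= load (3 * ♮nod + 1) ;; store ♮wid 1 ;; store (♮wid + 1) 0 ;; store (♮wid + 2) 0 ;;
      store (♮wid + 3) 0 ;; store (♮wid + 4) 0 ;; store (♮wid + (2 + 2 * ♮val)) 1) ;;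
  rem ::= ♮rem - 1

/-- Describe the strings derived from all nonterminals. -/
def buildNodes (p q : ℕ) : Cmd :=
  rem ::= ♮num ;; loop rem (nodeBody p q)

/-- One step down in the derivation tree, for the computation of `lastPos`: the string derived
from `nod` starts after the position `off`, the bound on the position is `rem` within it, and
`res` is the result if it contains no suitable position. -/
def descendBody (p q : ℕ) : Cmd :=
  ite (load (3 * ♮nod))
    (lft ::= load (3 * ♮nod + lit p) ;; rgt ::= load (3 * ♮nod + lit q) ;;
      val ::= load (3 * ♮num + 5 * ♮lft) ;;
      ite (lt ♮val ♮rem)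
        (lft ::= load (3 * ♮num + 5 * ♮lft + (1 + 2 * ♮argB + (♮argQ + ♮off) % 2)) ;;
          ite ♮lft (res ::= ♮off + ♮lft) skip ;;
          off ::= ♮off + ♮val ;; rem ::= ♮rem - ♮val ;; nod ::= ♮rgt)
        (nod ::= ♮lft))
    (ite (♮rem * (equal (load (3 * ♮nod + 1)) ♮argB * equal ((♮off + 1) % 2) ♮argQ))
        (res ::= ♮off + 1) skip ;;
      go ::= 0)

/-- Compute `lastPos` for the string derived from the start symbol. -/
def descend (p q : ℕ) : Cmd :=
  nod ::= ♮num - 1 ;; off ::= 0 ;; rem ::= ♮argU ;; res ::= 0 ;; go ::= 1 ;;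
  loop go (descendBody p q)

theorem nodeCell_ends {w a M : ℕ} {A B : List Bool} {b : Bool} {q : ℕ} (hq : q < 2) {σ : Env}
    (hw : 2 * M + a + 20 < 2 ^ w) (hM : A.length + B.length ≤ M) (ha : σ.reg wid = a)
    (hl : σ.reg lft < a) (hr : σ.reg rgt < a) (hA : IsNode σ.mem (σ.reg lft) A)
    (hB : IsNode σ.mem (σ.reg rgt) B) (ho : σ.reg off = A.length) :
    Ends w (nodeCell b q) σ 60 fun τ _ =>
      τ.mem = Function.update σ.mem (a + (1 + 2 * b.toNat + q))
        (lastPos (charFn (A ++ B)) b q (A ++ B).length) ∧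
      ∀ v, v ≠ val → τ.reg v = σ.reg v := by
  have hb := Bool.toNat_le b
  have hA' := hA.last b q hq
  have hB' := hB.last b ((q + A.length) % 2) (Nat.mod_lt _ two_pos)
  have lA := lastPos_le (charFn A) b q A.length
  have lB := lastPos_le (charFn B) b ((q + A.length) % 2) B.length
  rw [List.length_append, lastPos_append_right hq]
  generalize lastPos (charFn B) b ((q + A.length) % 2) B.length = y at *
  generalize lastPos (charFn A) b q A.length = z at *
  simp only [nodeCell, ends_seq, ends_assign, ends_ite, ends_store, add_def, mod_def, ofNat_def,
    Expr.eval, Expr.Fits, Expr.cost, WordOp.eval, ho]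
  simp only [Env.set_reg, Env.set_mem, reduceCtorEq, if_false, if_true, ha, ho, hA', hB']
  have hm : (q + A.length) % 2 < 2 := Nat.mod_lt _ two_pos
  generalize (q + A.length) % 2 = r at *
  refine ⟨by omega, by omega, by omega, by omega, fun hy => ?_, fun hy => ?_⟩
  · refine ⟨by omega, by omega, by omega, by rw [if_pos hy]; rfl, fun v hv => ?_⟩
    simp [hv]
  · refine ⟨by omega, by omega, by omega, by rw [if_neg (not_not.2 hy)]; rfl, fun v hv => ?_⟩
    simp [hv]

theorem nodeCells_ends {w a M : ℕ} {A B : List Bool} {σ : Env}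
    (hw : 2 * M + a + 20 < 2 ^ w) (hM : A.length + B.length ≤ M) (ha : σ.reg wid = a)
    (hl : σ.reg lft + 5 ≤ a) (hr : σ.reg rgt + 5 ≤ a) (hA : IsNode σ.mem (σ.reg lft) A)
    (hB : IsNode σ.mem (σ.reg rgt) B) (ho : σ.reg off = A.length)
    (hlen : σ.mem a = (A ++ B).length) :
    Ends w nodeCells σ 240 fun τ _ =>
      (∀ i < a, τ.mem i = σ.mem i) ∧ IsNode τ.mem a (A ++ B) ∧
        ∀ v, v ≠ val → τ.reg v = σ.reg v := by
  have step : ∀ {b : Bool} {q : ℕ} {τ : Env}, q < 2 → (∀ i < a, τ.mem i = σ.mem i) →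
      (∀ v, v ≠ val → τ.reg v = σ.reg v) → Ends w (nodeCell b q) τ 60 fun ρ _ =>
        ρ.mem = Function.update τ.mem (a + (1 + 2 * b.toNat + q))
          (lastPos (charFn (A ++ B)) b q (A ++ B).length) ∧ (∀ i < a, ρ.mem i = σ.mem i) ∧
        ∀ v, v ≠ val → ρ.reg v = σ.reg v := by
    intro b q τ hq h1 h2
    have hl' := h2 lft (by simp)
    have hr' := h2 rgt (by simp)
    refine (nodeCell_ends (b := b) hq hw hM ((h2 wid (by simp)).trans ha) (by omega) (by omega)
      (hl' ▸ hA.congr fun i hi => h1 i (by omega)) (hr' ▸ hB.congr fun i hi => h1 i (by omega))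
      ((h2 off (by simp)).trans ho)).mono le_rfl ?_
    rintro ρ _ _ ⟨g1, g2⟩ -
    refine ⟨g1, fun i hi => ?_, fun v hv => (g2 v hv).trans (h2 v hv)⟩
    rw [g1, Function.update_of_ne (by omega), h1 i hi]
  rw [nodeCells, ends_seq]
  refine (step (by omega) (fun _ _ => rfl) fun _ _ => rfl).mono (by omega) ?_
  rintro τ₁ _ T₁ ⟨a1, a2, a3⟩ _
  rw [ends_seq]
  refine (step (by omega) a2 a3).mono (by omega) ?_
  rintro τ₂ _ T₂ ⟨b1, b2, b3⟩ _
  rw [ends_seq]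
  refine (step (by omega) b2 b3).mono (by omega) ?_
  rintro τ₃ _ T₃ ⟨c1, c2, c3⟩ _
  refine (step (by omega) c2 c3).mono (by omega) ?_
  rintro τ₄ _ T₄ ⟨d1, d2, d3⟩ _
  refine ⟨d2, ⟨?_, fun b q hq => ?_⟩, d3⟩
  · simp [d1, c1, b1, a1, hlen]
  · rw [d1, c1, b1, a1]
    interval_cases q <;> cases b <;> simp

theorem nodeBody_ends {w m l p q M : ℕ} {x : ℕ → ℕ} {E : ℕ → List Bool} {σ : Env}
    (hd : Derives m x p q E) (hp : p < 3) (hq : q < 3)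
    (hw : 10 * M + 10 * m + 40 < 2 ^ w) (hM : ∀ i < m, (E i).length ≤ M) (hl : l < m)
    (h : IsNodeTable m x E l σ.mem) (hm : σ.reg num = m) (hr : σ.reg rem = m - l) :
    Ends w (nodeBody p q) σ 500 fun τ _ =>
      IsNodeTable m x E (l + 1) τ.mem ∧ τ.reg num = m ∧ τ.reg rem = m - (l + 1) ∧
        τ.reg out = σ.reg out := by
  have hw0 : w ≠ 0 := by
    rintro rfl
    omega
  have e1 : m - (m - l) = l := by omega
  have hEl := hM l hl
  simp only [nodeBody, ends_seq, ends_assign, ends_ite, ends_store, add_def, sub_def, mul_def,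
    ofNat_def, Expr.eval, Expr.Fits, Expr.cost, WordOp.eval]
  simp only [Env.set_reg, Env.set_mem, Env.write_mem, Env.write_reg, reduceCtorEq, if_false,
    if_true, hm, hr, e1, h.input (3 * l) (by omega), h.input (3 * l + 1) (by omega),
    h.input (3 * l + p) (by omega), h.input (3 * l + q) (by omega)]
  rcases hd l hl with ⟨c, hc0, hc1, hE⟩ | ⟨hc0, hj, hk, hE⟩
  · have hc := Bool.toNat_le c
    simp only [hc0, hc1, ne_eq, not_true_eq_false, false_imp_iff, true_and, true_imp_iff]
    rw [hE] at hEl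
    repeat' apply And.intro
    any_goals first | trivial | rfl | omega
    refine h.succ (fun a ha => ?_) ?_
    · simp only [Function.update_apply]
      repeat rw [if_neg (by omega)]
    · rw [hE]
      refine ⟨?_, fun b r hr => ?_⟩
      · simp
      · rw [lastPos_singleton (by simp)]
        interval_cases r <;> cases b <;> cases c <;> simp
  · have hjM := hM _ (hj.trans hl)
    have hkM := hM _ (hk.trans hl)
    have nj := h.node _ hj
    have nk := h.node _ hk
    have hEl' := hEl
    rw [hE, List.length_append] at hEl'
    simp only [hc0, ne_eq, one_ne_zero, not_false_eq_true, true_imp_iff, false_imp_iff, and_true,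
      nj.length, nk.length]
    repeat' apply And.intro
    any_goals omega
    refine (nodeCells_ends (a := 3 * m + 5 * l) (M := M) (by omega) hEl' ?_ ?_ ?_
      (nj.congr ?_) (nk.congr ?_) ?_ ?_).mono (by omega) ?_
    on_goal 8 =>
      rintro τ _ T ⟨g1, g2, g3⟩ hT
      have r1 := g3 num (by simp)
      have r2 := g3 rem (by simp)
      have r3 := g3 out (by simp)
      simp [hm, hr] at r1 r2 r3
      refine ⟨by omega, by omega, h.succ (fun a ha => ?_) (hE ▸ g2), by simpa using r1, ?_,
        by simpa using r3⟩
      · rw [g1 a ha]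
        exact Function.update_of_ne (by omega) ..
      · omega
    on_goal 4 => exact fun i hi => Function.update_of_ne (by omega) ..
    on_goal 4 => exact fun i hi => Function.update_of_ne (by omega) ..
    all_goals simp
    all_goals omega

theorem buildNodes_ends {w m p q M : ℕ} {x : ℕ → ℕ} {E : ℕ → List Bool} {σ : Env}
    (hd : Derives m x p q E) (hp : p < 3) (hq : q < 3)
    (hw : 10 * M + 10 * m + 40 < 2 ^ w) (hM : ∀ i < m, (E i).length ≤ M)
    (h : ∀ a < 3 * m, σ.mem a = x a) (hm : σ.reg num = m) :
    Ends w (buildNodes p q) σ (501 * m + 10) fun τ _ =>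
      IsNodeTable m x E m τ.mem ∧ τ.reg num = m ∧ τ.reg out = σ.reg out := by
  simp only [buildNodes, ends_seq, ends_assign, Expr.eval, Expr.Fits, Expr.cost, hm]
  refine ⟨by omega, by omega, ?_⟩
  refine (ends_loop (k := m) (fun k τ => k ≤ m ∧ τ.reg rem = k ∧ IsNodeTable m x E (m - k) τ.mem ∧
    τ.reg num = m ∧ τ.reg out = σ.reg out) 500 ?_ ?_).mono (by omega) ?_
  · refine ⟨le_rfl, by simp, ⟨h, fun i hi => by omega⟩, by simpa using hm, by simp⟩
  · rintro k τ ⟨h1, h2, h3, h4, h5⟩ hne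
    refine ⟨k - 1, by omega, (nodeBody_ends hd hp hq hw hM (l := m - k) (by omega) h3 h4
      (by omega)).mono le_rfl ?_⟩
    rintro ρ _ _ ⟨g1, g2, g3, g4⟩ -
    exact ⟨by omega, by omega, by rwa [show m - (k - 1) = m - k + 1 by omega], g2, g4.trans h5⟩
  · rintro ρ _ _ ⟨⟨k, h1, h2, h3, h4, h5⟩, h6⟩ -
    obtain rfl : k = 0 := by omega
    exact ⟨h3, h4, h5⟩

/-- The state of the descent: the answer `r` is the last suitable position among the first
`rem` characters derived from the nonterminal `nod`, or `res` if there is none; at most `k`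
steps remain. -/
structure IsDescent (m n : ℕ) (E : ℕ → List Bool) (b : Bool) (q r k : ℕ) (τ : Env) : Prop where
  res_le : τ.reg res ≤ n
  state : τ.reg go = 0 ∧ τ.reg res = r ∨
    τ.reg go ≠ 0 ∧ τ.reg nod < m ∧ τ.reg nod < k ∧ τ.reg rem ≤ (E (τ.reg nod)).length ∧
      τ.reg off + (E (τ.reg nod)).length ≤ n ∧
      r = if lastPos (charFn (E (τ.reg nod))) b ((q + τ.reg off) % 2) (τ.reg rem) ≠ 0 then
          τ.reg off + lastPos (charFn (E (τ.reg nod))) b ((q + τ.reg off) % 2) (τ.reg rem)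
        else τ.reg res

theorem descendBody_ends {w m n p q' : ℕ} {x : ℕ → ℕ} {E : ℕ → List Bool} {b : Bool}
    {q r k : ℕ} {σ : Env}
    (hd : Derives m x p q' E) (hp : p < 3) (hq' : q' < 3)
    (hw : 10 * n + 10 * m + 40 < 2 ^ w) (h : IsNodeTable m x E m σ.mem) (hm : σ.reg num = m)
    (hb : σ.reg argB = b.toNat) (hq : σ.reg argQ = q) (hq2 : q < 2)
    (hI : IsDescent m n E b q r (k + 1) σ) (hgo : σ.reg go ≠ 0) :
    Ends w (descendBody p q') σ 200 fun τ _ =>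
      IsDescent m n E b q r k τ ∧ τ.mem = σ.mem ∧
        ∀ v, v.isScratch = false → τ.reg v = σ.reg v := by
  have hw0 : w ≠ 0 := by
    rintro rfl
    omega
  have hb' := Bool.toNat_le b
  obtain ⟨hres, ⟨h0, -⟩ | ⟨-, hi, hik, hrem, hoff, hr⟩⟩ := hI
  · exact absurd h0 hgo
  generalize hi0 : σ.reg nod = i at *
  generalize ho0 : σ.reg off = o at *
  generalize hu0 : σ.reg Var.rem = u at *
  simp only [descendBody, ends_seq, ends_assign, ends_ite, ends_skip, add_def, sub_def, mul_def,
    mod_def, Expr.lt, equal, ofNat_def, Expr.eval, Expr.Fits, Expr.cost, WordOp.eval]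
  simp only [Env.set_reg, Env.set_mem, reduceCtorEq, if_false,
    if_true, hm, hi0, ho0, hu0, hb, hq, h.input (3 * i) (by omega), h.input (3 * i + 1) (by omega),
    h.input (3 * i + p) (by omega), h.input (3 * i + q') (by omega)]
  rcases hd i hi with ⟨c, hc0, hc1, hE⟩ | ⟨hc0, hj, hk, hE⟩
  · have hc := Bool.toNat_le c
    simp only [hc0, hc1, ne_eq, not_true_eq_false, false_imp_iff, true_and, true_imp_iff]
    rw [hE] at hrem hoff hr
    rw [lastPos_singleton hrem] at hr
    simp only [List.length_singleton] at hrem hoff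
    have hcb : c.toNat = b.toNat ↔ c = b := by cases c <;> cases b <;> simp
    have hpar : (o + 1) % 2 = q ↔ (q + o) % 2 = 1 := by omega
    simp only [hcb, hpar]
    by_cases hall : u = 1 ∧ c = b ∧ (q + o) % 2 = 1
    · rw [if_pos hall] at hr
      obtain ⟨rfl, rfl, h3⟩ := hall
      simp only [h3, if_true, one_ne_zero, mul_one, not_false_eq_true, true_imp_iff,
        false_imp_iff, and_true]
      repeat' apply And.intro
      any_goals first | trivial | omega
      · exact ⟨by simp; omega, Or.inl (by simp [hr])⟩
      · intro v hv
        cases v <;> simp [isScratch] at hv ⊢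
    · rw [if_neg hall] at hr
      have hz : u * ((if c = b then 1 else 0) * if (q + o) % 2 = 1 then 1 else 0) = 0 := by
        rcases Nat.eq_zero_or_pos u with rfl | hu
        · simp
        · have : ¬ (c = b ∧ (q + o) % 2 = 1) := fun h => hall ⟨by omega, h⟩
          by_cases h1 : c = b
          · rw [if_neg fun h2 => this ⟨h1, h2⟩]
            simp
          · simp [h1]
      have hz1 : (if c = b then 1 else 0) ≤ 1 := by split_ifs <;> omega
      have hz2 : (if (q + o) % 2 = 1 then 1 else 0) ≤ 1 := by split_ifs <;> omega
      have hz3 : (if c = b then 1 else 0) * (if (q + o) % 2 = 1 then 1 else 0) ≤ 1 :=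
        Nat.mul_le_mul hz1 hz2
      simp only [hz, not_true_eq_false, true_imp_iff, false_imp_iff, true_and]
      repeat' apply And.intro
      any_goals first | trivial | omega
      · exact ⟨by simpa using hres, Or.inl (by simp [hr])⟩
      · intro v hv
        cases v <;> simp [isScratch] at hv ⊢
  · have nj := (h.node _ (hj.trans hi)).length
    have hl := (h.node _ (hj.trans hi)).last b ((q + o) % 2) (Nat.mod_lt _ two_pos)
    rw [hE] at hr hrem hoff
    generalize x (3 * i + p) = j at *
    generalize x (3 * i + q') = j' at *
    rw [List.length_append] at hrem hoff
    simp only [hc0, ne_eq, one_ne_zero, not_false_eq_true, true_imp_iff, false_imp_iff, and_true,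
      nj]
    by_cases hju : (E j).length < u
    · obtain ⟨u', rfl⟩ : ∃ u', u = (E j).length + u' := ⟨u - (E j).length, by omega⟩
      rw [lastPos_append_right (Nat.mod_lt _ two_pos),
        show ((q + o) % 2 + (E j).length) % 2 = (q + (o + (E j).length)) % 2 by omega] at hr
      have hle := lastPos_le (charFn (E j)) b ((q + o) % 2) (E j).length
      simp only [hju, if_true, hl, one_ne_zero, not_false_eq_true, true_imp_iff, false_imp_iff,
        and_true]
      generalize lastPos (charFn (E j)) b ((q + o) % 2) (E j).length = v at *
      repeat' apply And.intro
      any_goals first | trivial | omega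
      all_goals intro hv
      all_goals repeat' apply And.intro
      any_goals first | trivial | omega
      · refine ⟨by simp; omega, Or.inr ?_⟩
        simp only [Env.set_reg, reduceCtorEq, if_false, if_true]
        refine ⟨hgo, by omega, by omega, by omega, by omega, ?_⟩
        rw [hr, Nat.add_sub_cancel_left]
        split_ifs <;> omega
      · intro u hu
        cases u <;> simp [isScratch] at hu ⊢
      · refine ⟨by simpa using hres, Or.inr ?_⟩
        simp only [Env.set_reg, reduceCtorEq, if_false, if_true]
        refine ⟨hgo, by omega, by omega, by omega, by omega, ?_⟩
        rw [hr, Nat.add_sub_cancel_left]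
        split_ifs <;> omega
      · intro u hu
        cases u <;> simp [isScratch] at hu ⊢
    · rw [lastPos_append_left (by omega)] at hr
      simp only [hju, if_false, not_true_eq_false, true_imp_iff, false_imp_iff, true_and]
      repeat' apply And.intro
      any_goals first | trivial | omega
      · refine ⟨by simpa using hres, Or.inr ?_⟩
        simp only [Env.set_reg, reduceCtorEq, if_false, if_true, ho0, hu0]
        exact ⟨hgo, by omega, by omega, by omega, by omega, hr⟩
      · intro v hv
        cases v <;> simp [isScratch] at hv ⊢

end Cmd

/-! ### The decision procedure for grammars -/
namespace Cmd

open Expr Var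

theorem descend_computes {w m n p q' : ℕ} {x μ : ℕ → ℕ} {E : ℕ → List Bool} {s : ℕ → Bool}
    (hd : Derives m x p q' E) (hp : p < 3) (hq' : q' < 3)
    (hw : 10 * n + 10 * m + 40 < 2 ^ w) (h : IsNodeTable m x E m μ) (hm0 : 0 < m)
    (hn : (E (m - 1)).length = n) (hs : ∀ i, 0 < i → i ≤ n → charFn (E (m - 1)) i = s i) :
    ComputesLastPos w (descend p q') (201 * m + 60) μ m n s := by
  intro σ b hμ hm _ hb hq hu
  have hw0 : w ≠ 0 := by
    rintro rfl
    omega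
  simp only [descend, ends_seq, ends_assign, sub_def, ofNat_def, Expr.eval, Expr.Fits, Expr.cost,
    WordOp.eval]
  simp only [Env.set_reg, reduceCtorEq, if_false, hm]
  refine ⟨by omega, by omega, by omega, by omega, by omega, by omega, by omega, by omega, by omega,
    by omega, ?_⟩
  refine (ends_loop (k := m) (fun k τ => IsDescent m n E b (σ.reg argQ)
    (lastPos s b (σ.reg argQ) (σ.reg argU)) k τ ∧ τ.mem = μ ∧
    ∀ v, v.isScratch = false → τ.reg v = σ.reg v) 200 ?_ ?_).mono (by omega) ?_
  · refine ⟨⟨by simp, Or.inr ?_⟩, hμ, fun v hv => by cases v <;> simp [isScratch] at hv ⊢⟩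
    simp only [Env.set_reg, reduceCtorEq, if_false, if_true]
    refine ⟨one_ne_zero, by omega, by omega, by omega, by omega, ?_⟩
    rw [add_zero, Nat.mod_eq_of_lt hq, zero_add,
      lastPos_congr fun i h0 hi => hs i h0 (hi.trans hu)]
    split_ifs <;> omega
  · rintro k τ ⟨hI, h1, h2⟩ hne
    obtain ⟨k', rfl⟩ : ∃ k', k = k' + 1 := by
      obtain ⟨-, h3 | h3⟩ := hI
      · exact absurd h3.1 hne
      · exact ⟨k - 1, by omega⟩
    refine ⟨k', rfl, (descendBody_ends hd hp hq' hw (h1 ▸ h) ((h2 num rfl).trans hm)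
      ((h2 argB rfl).trans hb) (h2 argQ rfl) hq hI hne).mono le_rfl ?_⟩
    rintro ρ _ _ ⟨g1, g2, g3⟩ -
    exact ⟨g1, g2.trans h1, fun v hv => (g3 v hv).trans (h2 v hv)⟩
  · rintro τ _ _ ⟨⟨k, hI, h1, h2⟩, h3⟩ -
    refine ⟨τ.reg, ?_, ?_⟩
    · obtain ⟨r, μ'⟩ := τ
      unfold Env.havoc
      congr 1
      · funext v
        cases hv : v.isScratch
        · simpa using h2 v hv
        · simp
      · exact h1.trans hμ.symm
    · obtain ⟨-, h4 | h4⟩ := hI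
      · exact h4.2
      · exact absurd h3 h4.1

/-- Describe the strings derived from the nonterminals, and look up the length of the whole. -/
def prepare (p q : ℕ) : Cmd :=
  buildNodes p q ;; len ::= load (3 * ♮num + 5 * (♮num - 1))

theorem prepare_ends {w m n p q M : ℕ} {x : ℕ → ℕ} {E : ℕ → List Bool} {σ : Env}
    (hd : Derives m x p q E) (hp : p < 3) (hq : q < 3)
    (hw : 10 * M + 10 * m + 40 < 2 ^ w) (hM : ∀ i < m, (E i).length ≤ M)
    (h : ∀ a < 3 * m, σ.mem a = x a) (hm : σ.reg num = m) (hm0 : 0 < m)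
    (hn : (E (m - 1)).length = n) :
    Ends w (prepare p q) σ (501 * m + 40) fun τ _ =>
      IsNodeTable m x E m τ.mem ∧ τ.reg num = m ∧ τ.reg out = σ.reg out ∧ τ.reg len = n := by
  have hw0 : w ≠ 0 := by
    rintro rfl
    omega
  have hnM := hM (m - 1) (by omega)
  rw [prepare, ends_seq]
  refine (buildNodes_ends hd hp hq hw hM h hm).mono (by omega) ?_
  rintro τ _ T ⟨h1, h2, h3⟩ hT
  have h4 := (h1.node (m - 1) (by omega)).length
  simp only [ends_assign, add_def, sub_def, mul_def, ofNat_def, Expr.eval, Expr.Fits, Expr.cost,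
    WordOp.eval, h2, h4]
  exact ⟨by omega, by omega, h1, by simpa using h2, by simpa using h3, by simpa using hn⟩

/-- The decision procedure for strings given by grammars. For the reversed string, the two
nonterminals of each pair change places. -/
def decideGrammar : Cmd :=
  num ::= ♮out / 3 ;; out ::= 0 ;;
  prepare 1 2 ;; detectBoth (descend 1 2) ;;
  prepare 2 1 ;; detectBoth (descend 2 1)

theorem decideGrammar_ends {w m n k M : ℕ} {x : ℕ → ℕ} {E : ℕ → List Bool} {σ : Env}
    (hd : Derives m x 1 2 E) (hd' : Derives m x 2 1 fun i => (E i).reverse)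
    (hw : 10 * M + 10 * m + 40 < 2 ^ w) (hM : ∀ i < m, (E i).length ≤ M) (hk : n < 2 ^ k)
    (h : ∀ a < 3 * m, σ.mem a = x a) (hm : σ.reg out = 3 * m) (hm0 : 0 < m)
    (hn : (E (m - 1)).length = n) :
    Ends w decideGrammar σ (1002 * m + 100 + 2 * ((k + 4) * (20 * (201 * m + 60) + 1000)))
      fun τ _ => τ.reg out ≠ 0 ↔ HasThreeCadence n (charFn (E (m - 1))) := by
  have hnM := hM (m - 1) (by omega)
  simp only [decideGrammar, ends_seq, ends_assign, div_def, ofNat_def, Expr.eval, Expr.Fits,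
    Expr.cost, WordOp.eval, hm]
  refine ⟨by omega, by omega, by omega, by omega, ?_⟩
  refine (prepare_ends hd (by omega) (by omega) hw hM ?_ ?_ hm0 hn).mono (by omega) ?_
  · simpa using h
  · simp
  rintro σ₁ _ T₁ ⟨a1, a2, a3, a4⟩ hT₁
  refine (detectBoth_ends (descend_computes hd (by omega) (by omega) (by omega) a1 hm0 hn
    fun _ _ _ => rfl) (by omega) hk rfl a2 a4).mono (by omega) ?_
  rintro σ₂ _ T₂ ⟨b1, b2, -, b3⟩ hT₂
  refine (prepare_ends (n := n) hd' (by omega) (by omega) hw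
    (fun i hi => by simpa using hM i hi) (b1 ▸ a1.input) b2 hm0 (by simpa using hn)).mono
    (by omega) ?_
  rintro σ₃ _ T₃ ⟨c1, c2, c3, c4⟩ hT₃
  refine (detectBoth_ends (s := revPos n (charFn (E (m - 1)))) (descend_computes hd' (by omega)
    (by omega) (by omega) c1 hm0 (by simpa using hn) ?_) (by omega) hk rfl c2 c4).mono (by omega) ?_
  · intro i h0 hi
    simp only [charFn, revPos, List.getD_eq_getElem?_getD]
    rw [List.getElem?_reverse (by omega)]
    congr 2
    omega
  rintro σ₄ _ T₄ ⟨-, -, -, d⟩ -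
  rw [d, c3, b3, a3, hasThreeCadence_iff hk]
  simp

end Cmd

/-! ### The encoding of a grammar -/

theorem getElem?_flatMap_of_length_eq_three {α β : Type*} {f : α → List β}
    (hf : ∀ a, (f a).length = 3) (L : List α) (i : ℕ) {r : ℕ} (hr : r < 3) :
    (L.flatMap f)[3 * i + r]? = L[i]?.bind fun a => (f a)[r]? := by
  induction L generalizing i with
  | nil => simp
  | cons a L ih =>
    rw [List.flatMap_cons]
    cases i with
    | zero => simp [List.getElem?_append_left (show r < (f a).length by rw [hf]; exact hr)]
    | succ i =>
      rw [List.getElem?_append_right (by rw [hf]; omega), hf,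
        show 3 * (i + 1) + r - 3 = 3 * i + r by omega, ih]
      simp

theorem encodeRule_length {i : ℕ} (r : GrammarRule Bool i) : (encodeRule r).length = 3 := by
  cases r <;> rfl

theorem getD_encodeGrammar (G : StraightLineGrammar Bool) {i r : ℕ} (hi : i < G.size)
    (hr : r < 3) :
    (encodeGrammar G).getD (3 * i + r) 0 = (encodeRule (G.rhs ⟨i, hi⟩)).getD r 0 := by
  rw [List.getD_eq_getElem?_getD, encodeGrammar,
    getElem?_flatMap_of_length_eq_three (fun _ => encodeRule_length _) _ _ hr]
  simp [hi]

theorem encodeGrammar_length (G : StraightLineGrammar Bool) :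
    (encodeGrammar G).length = 3 * G.size := by
  simp [encodeGrammar, List.length_flatMap, encodeRule_length, mul_comm]

theorem lt_of_mem_encodeGrammar {G : StraightLineGrammar Bool} {v : ℕ}
    (hv : v ∈ encodeGrammar G) : v < G.size + 2 := by
  obtain ⟨i, -, hi⟩ := List.mem_flatMap.1 hv
  cases hr : G.rhs i with
  | char a =>
    have := Bool.toNat_le a
    simp only [hr, encodeRule, List.mem_cons, List.not_mem_nil, or_false] at hi
    omega
  | pair j k =>
    simp only [hr, encodeRule, List.mem_cons, List.not_mem_nil, or_false] at hi
    omega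

/-- The string derived from a nonterminal, as a function on all natural numbers. -/
def StraightLineGrammar.expandFn (G : StraightLineGrammar Bool) (i : ℕ) : List Bool :=
  if h : i < G.size then G.expand i h else []

theorem derives_encodeGrammar (G : StraightLineGrammar Bool) :
    Derives G.size (fun a => (encodeGrammar G).getD a 0) 1 2 G.expandFn := by
  intro i hi
  have h0 := getD_encodeGrammar G hi (r := 0) (by omega)
  have h1 := getD_encodeGrammar G hi (r := 1) (by omega)
  have h2 := getD_encodeGrammar G hi (r := 2) (by omega)
  rw [add_zero] at h0
  simp only [h0, h1, h2]
  cases hr : G.rhs ⟨i, hi⟩ with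
  | char a =>
    refine Or.inl ⟨a, by simp [encodeRule], by simp [encodeRule], ?_⟩
    rw [StraightLineGrammar.expandFn, dif_pos hi, StraightLineGrammar.expand]
    simp [hr]
  | pair j k =>
    refine Or.inr ⟨by simp [encodeRule], by simp [encodeRule], by simp [encodeRule], ?_⟩
    simp only [encodeRule, List.getD_cons_succ, List.getD_cons_zero]
    rw [StraightLineGrammar.expandFn, dif_pos hi, StraightLineGrammar.expand,
      StraightLineGrammar.expandFn, dif_pos (j.isLt.trans hi),
      StraightLineGrammar.expandFn, dif_pos (k.isLt.trans hi)]
    simp [hr]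

theorem Derives.reverse {m : ℕ} {x : ℕ → ℕ} {p q : ℕ} {E : ℕ → List Bool}
    (h : Derives m x p q E) : Derives m x q p fun i => (E i).reverse := by
  intro i hi
  rcases h i hi with ⟨c, h1, h2, h3⟩ | ⟨h1, h2, h3, h4⟩
  · exact Or.inl ⟨c, h1, h2, by simp [h3]⟩
  · exact Or.inr ⟨h1, h3, h2, by simp [h4]⟩

theorem polyTimeSolvable_hasCadence :
    PolyTimeSolvable encodeGrammar StraightLineGrammar.size
      (fun G : StraightLineGrammar Bool => HasCadence G.word 3) := by
  refine ⟨Cmd.decideGrammar.compile,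
    Polynomial.C 20000 * (Polynomial.X + 1) ^ 2, fun G => ?_⟩
  have hm0 := G.size_pos
  have hword : G.expandFn (G.size - 1) = G.word := by
    rw [StraightLineGrammar.expandFn, dif_pos (by omega)]
    rfl
  have hd := derives_encodeGrammar G
  have hin : ∀ a < 3 * G.size, (Env.init (encodeGrammar G)).mem a =
    (encodeGrammar G).getD a 0 := fun _ _ => rfl
  have hlen := encodeGrammar_length G
  have hval := @lt_of_mem_encodeGrammar G
  set m := G.size with hm
  have heval : (Polynomial.C 20000 * (Polynomial.X + 1) ^ 2 : Polynomial ℕ).eval m =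
      20000 * (m + 1) ^ 2 := by simp
  simp only [heval, hasCadence_three_iff, ← hword]
  have hsq : m + 1 ≤ (m + 1) ^ 2 := Nat.le_self_pow two_ne_zero _
  have hpow : m < 2 ^ m := Nat.lt_two_pow_self
  -- the strings derived from the nonterminals have length at most `2 ^ m`
  have hw : 10 * 2 ^ m + 10 * m + 40 < 2 ^ (20000 * (m + 1) ^ 2) :=
    calc 10 * 2 ^ m + 10 * m + 40 < 2 ^ 10 * 2 ^ m := by omega
      _ = 2 ^ (10 + m) := (pow_add ..).symm
      _ ≤ _ := Nat.pow_le_pow_right two_pos (by omega)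
  have hM : ∀ i < m, (G.expandFn i).length ≤ 2 ^ m := fun i hi =>
    (hd.length_le hi).trans (Nat.pow_le_pow_right two_pos hi.le)
  have hk : (G.expandFn (m - 1)).length < 2 ^ m :=
    (hd.length_le (by omega)).trans_lt (Nat.pow_lt_pow_right one_lt_two (by omega))
  apply Cmd.decides_of_ends
  · omega
  · intro v hv
    have := hval hv
    omega
  · refine (Cmd.decideGrammar_ends hd hd.reverse hw hM hk hin ?_ hm0 rfl).mono ?_
      fun _ _ _ h _ => h
    · simpa [Env.init] using hlen
    · nlinarith

/-- Whether a binary string has a 3-cadence can be decided in polynomial time if the string is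
given by a straight-line grammar, and in linear time if it is given uncompressed. -/
theorem mainTheorem4 :
    PolyTimeSolvable encodeGrammar StraightLineGrammar.size
        (fun G : StraightLineGrammar Bool => HasCadence G.word 3) ∧
      LinearTimeSolvable encodeString List.length
        (fun S : List Bool => HasCadence S 3) :=
  ⟨polyTimeSolvable_hasCadence, linearTimeSolvable_hasCadence⟩
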